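/- Let $I\subset\mathbb R$ be an interval (bounded or not). A *density* on $I$ means here a function $\rho\ge 0$ on $I$ with $\int_I\rho=1$, with finite moments of every order, such that the polynomials are dense in $L^2(I,\rho)=L^2(I,\rho(x)\,dx)$. Put $S_\rho(z)=\int_I\frac{\rho(t)\,dt}{z-t}$, $c_1=\int_I t\rho(t)\,dt$. A *secondary density* of $\rho$ is a function $\mu\ge 0$ on $I$ with finite moments of every order and $S_\mu(z)=z-c_1-\frac1{S_\rho(z)}$ for $z\in\mathbb C\setminus\overline I$. Let $T_\rho:L^2(I,\rho)\to L^2(I,\mu)$ be the extension by continuity, from the polynomials, of $f\mapsto\big(x\mapsto\int_I\frac{f(t)-f(x)}{t-x}\rho(t)\,dt\big)$: that is, $T_\rho f=g$ if there are polynomials $p_n\to f$ in $L^2(I,\rho)$ with $T_\rho p_n\to g$ in $L^2(I,\mu)$. The *reducer* of $\rho$ is $$\varphi(x)=\lim_{\varepsilon\to0^+}2\int_I\frac{(x-t)\rho(t)\,dt}{(x-t)^2+\varepsilon^2}.$$ The density $\rho$ is *reducible* if this limit exists for almost every $x\in I$ and also holds in the norm of $L^2(I,\rho)$, and if $\rho$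 has a secondary density $\mu$ such that $\rho/\mu$ belongs to the image of $T_\rho$. (a) If $\rho$ is a reducible density on $I$ with reducer $\varphi$, then $\varphi^2\rho$ and $\rho^3$ are integrable on $I$ and $$\int_I\varphi^2(x)\rho(x)\,dx=\frac{4\pi^2}{3}\int_I\rho^3(x)\,dx .$$ (b) If $\rho_1,\rho_2,\rho_3$ are reducible densities on $I$ with reducers $\varphi_1,\varphi_2,\varphi_3$, then the two integrands below are integrable on $I$ and $$\int_I\big[\varphi_1\varphi_2\rho_3+\varphi_1\varphi_3\rho_2+\varphi_2\varphi_3\rho_1\big](x)\,dx=4\pi^2\int_I\rho_1(x)\rho_2(x)\rho_3(x)\,dx .$$ -/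

import Mathlib

open MeasureTheory Filter Topology Polynomial
open scoped ENNReal

namespace SecondaryMeasure

noncomputable section

/-- The measure on `I` with density `w` with respect to Lebesgue measure. -/
def densityMeasure (I : Set ℝ) (w : ℝ → ℝ) : Measure ℝ :=
  (volume.restrict I).withDensity (fun x => ENNReal.ofReal (w x))

/-- A probability density on `I` with moments of all orders, such that the polynomials are
dense in `L²(I, ρ)`. -/
structure IsAdmissibleDensity (I : Set ℝ) (ρ : ℝ → ℝ) : Prop where
  nonneg : ∀ x ∈ I, 0 ≤ ρ x
  moments : ∀ n : ℕ, IntegrableOn (fun t => t ^ n * ρ t) I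
  integral_eq_one : ∫ t in I, ρ t = 1
  dense : ∀ f : ℝ → ℝ, MemLp f 2 (densityMeasure I ρ) → ∀ δ : ℝ≥0∞, 0 < δ →
    ∃ p : ℝ[X], eLpNorm (fun x => f x - p.eval x) 2 (densityMeasure I ρ) < δ

/-- The Stieltjes transform `S_w(z) = ∫_I w(t) / (z - t) dt`. -/
def stieltjes (I : Set ℝ) (w : ℝ → ℝ) (z : ℂ) : ℂ :=
  ∫ t in I, (w t : ℂ) / (z - (t : ℂ))

/-- `μ` is a density on `I` of the secondary measure of `ρ`: it is nonnegative, has moments of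
all orders, and `S_μ(z) = z - c₁ - 1 / S_ρ(z)` off the (closed) interval, where `c₁` is the
first moment of `ρ`. -/
structure IsSecondaryDensity (I : Set ℝ) (ρ μ : ℝ → ℝ) : Prop where
  nonneg : ∀ x ∈ I, 0 ≤ μ x
  moments : ∀ n : ℕ, IntegrableOn (fun t => t ^ n * μ t) I
  stieltjes_eq : ∀ z : ℂ, z ∉ Complex.ofReal '' closure I →
    stieltjes I μ z = z - ((∫ t in I, t * ρ t : ℝ) : ℂ) - 1 / stieltjes I ρ z

/-- The operator creating secondary polynomials,
`f ↦ (x ↦ ∫_I (f(t) - f(x)) / (t - x) ρ(t) dt)`. -/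
def secondaryOp (I : Set ℝ) (ρ : ℝ → ℝ) (f : ℝ → ℝ) (x : ℝ) : ℝ :=
  ∫ t in I, (f t - f x) / (t - x) * ρ t

/-- `T_ρ f = g`, where `T_ρ : L²(I, ρ) → L²(I, μ)` is the extension by continuity of
`secondaryOp I ρ` from the (dense) polynomials: some sequence of polynomials tends to `f` in
`L²(I, ρ)` while its images tend to `g` in `L²(I, μ)`. -/
def IsSecondaryImage (I : Set ℝ) (ρ μ f g : ℝ → ℝ) : Prop :=
  MemLp f 2 (densityMeasure I ρ) ∧ MemLp g 2 (densityMeasure I μ) ∧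
  ∃ p : ℕ → ℝ[X],
    Tendsto (fun n => eLpNorm (fun x => f x - (p n).eval x) 2 (densityMeasure I ρ))
      atTop (𝓝 0) ∧
    Tendsto (fun n => eLpNorm (fun x => g x - secondaryOp I ρ (fun t => (p n).eval t) x) 2
      (densityMeasure I μ)) atTop (𝓝 0)

/-- The regularised reducer `2 ∫_I (x - t) ρ(t) / ((x - t)² + ε²) dt`. -/
def regReducer (I : Set ℝ) (ρ : ℝ → ℝ) (ε x : ℝ) : ℝ :=
  2 * ∫ t in I, (x - t) * ρ t / ((x - t) ^ 2 + ε ^ 2)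

/-- The reducer `φ(x) = lim_{ε → 0⁺} 2 ∫_I (x - t) ρ(t) / ((x - t)² + ε²) dt`. -/
def reducer (I : Set ℝ) (ρ : ℝ → ℝ) (x : ℝ) : ℝ :=
  limUnder (𝓝[>] (0 : ℝ)) (fun ε => regReducer I ρ ε x)

/-- `ρ` is reducible: it is admissible, its reducer `φ` exists (almost everywhere on `I`), the
defining limit also holds in the norm of `L²(I, ρ)`, and `ρ` has a secondary measure, of
density `μ`, such that `ρ / μ` belongs to the image of `T_ρ`. -/
structure IsReducible (I : Set ℝ) (ρ : ℝ → ℝ) : Prop where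
  admissible : IsAdmissibleDensity I ρ
  exists_limit : ∀ᵐ x ∂(volume.restrict I),
    ∃ y : ℝ, Tendsto (fun ε => regReducer I ρ ε x) (𝓝[>] (0 : ℝ)) (𝓝 y)
  tendsto_norm : Tendsto
    (fun ε => eLpNorm (fun x => regReducer I ρ ε x - reducer I ρ x) 2 (densityMeasure I ρ))
    (𝓝[>] (0 : ℝ)) (𝓝 0)
  quotient_mem_range : ∃ μ : ℝ → ℝ, IsSecondaryDensity I ρ μ ∧
    ∃ f : ℝ → ℝ, IsSecondaryImage I ρ μ f (fun x => ρ x / μ x)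

end

end SecondaryMeasure

/-! Extend the densities by zero to the line and let `H_ε f` be convolution with `u / (u² + ε²)`, so
that the reducer of `ρ` is `2 lim H_ε ρ`. For the exact kernel `1/u`, the cyclic sum of `1 / ((x -
y)(x - z))` vanishes. After regularisation it becomes exactly `ε⁻² symKernel(·/ε)` in `(x - y, x -
z)` (`hilbertKernel_cyclic_sum`): a nonnegative approximate identity on the plane, of mass `π²`
(`integral_symKernel`). So the cyclic sum of `∫ f · H_ε g · H_ε h` averages `f g h` over points at
mutual distance of order `ε`, and tends to `π² ∫ f g h` when all three are in `L³`
(`tendsto_symForm`). The two factors `2` in a product of reducers turn `π²` into `4π²`; part (a) is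
the case of three equal densities.

Two analytic points remain. A reducible density is in `L³`: norm convergence bounds `∫ ρ (H_ε ρ)²`,
and since the symmetric kernel is nonnegative this bounds the cubes of all truncations of `ρ`
(`memLp_three_of_bound`). The limit passes inside `∫ g · H_ε f₁ · H_ε f₂`: a polarisation argument
bounds it uniformly in `ε` by `L³` norms (`integral_mul_hilbertReg_sq_le`), and it is small when `g`
is small in `L³`; this gives uniform integrability and tightness, and Vitali's theorem concludes. -/

namespace SecondaryMeasure

/-! ### The Cauchy profile and its convolutions -/

/-- The unnormalised Cauchy density `1 / (1 + s²)`. -/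
noncomputable def cauchyProfile (s : ℝ) : ℝ := (1 + s ^ 2)⁻¹

lemma cauchyProfile_pos (s : ℝ) : 0 < cauchyProfile s := by
  unfold cauchyProfile; positivity

lemma cauchyProfile_le_one (s : ℝ) : cauchyProfile s ≤ 1 :=
  inv_le_one_of_one_le₀ (by nlinarith [sq_nonneg s])

lemma cauchyProfile_neg (s : ℝ) : cauchyProfile (-s) = cauchyProfile s := by
  simp [cauchyProfile]

@[fun_prop]
lemma continuous_cauchyProfile : Continuous cauchyProfile := by
  unfold cauchyProfile
  exact Continuous.inv₀ (by fun_prop) fun s => by positivity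

lemma integrable_cauchyProfile : Integrable cauchyProfile := integrable_inv_one_add_sq

lemma integral_cauchyProfile : ∫ s, cauchyProfile s = Real.pi := integral_univ_inv_one_add_sq

/-- The two logarithms diverge separately; in the variable `r = 1/t` their quotient extends
continuously to `r = 0`. A general filter covers `+∞` and `-∞` together. -/
lemma tendsto_log_div_one_add_sq (s : ℝ) {l : Filter ℝ} (hl : Tendsto (fun t : ℝ => t⁻¹) l (𝓝 0))
    (hne : ∀ᶠ t in l, t ≠ 0) :
    Tendsto (fun t : ℝ => Real.log (1 + t ^ 2) - Real.log (1 + (s - t) ^ 2)) l (𝓝 0) := by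
  have hc : ContinuousAt (fun r : ℝ => Real.log ((r ^ 2 + 1) / (r ^ 2 + (s * r - 1) ^ 2))) 0 := by
    apply ContinuousAt.log
    · apply ContinuousAt.div (by fun_prop) (by fun_prop)
      norm_num
    · norm_num
  have h := hc.tendsto.comp hl
  simp only [ne_eq, OfNat.ofNat_ne_zero, not_false_eq_true, zero_pow, zero_add, mul_zero, zero_sub,
    even_two, Even.neg_pow, one_pow, div_one, Real.log_one] at h
  refine h.congr' ?_
  filter_upwards [hne] with t ht
  have h1 : (1 : ℝ) + t ^ 2 ≠ 0 := by positivity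
  have h2 : (1 : ℝ) + (s - t) ^ 2 ≠ 0 := by positivity
  rw [← Real.log_div h1 h2]
  simp only [Function.comp]
  congr 1
  have e1 : t⁻¹ ^ 2 + 1 = (1 + t ^ 2) / t ^ 2 := by field_simp
  have e2 : t⁻¹ ^ 2 + (s * t⁻¹ - 1) ^ 2 = (1 + (s - t) ^ 2) / t ^ 2 := by field_simp
  rw [e1, e2, div_div_div_cancel_right₀ (pow_ne_zero 2 ht)]

lemma integrable_cauchyProfile_mul_sub (s : ℝ) :
    Integrable fun t => cauchyProfile t * cauchyProfile (s - t) := by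
  refine integrable_cauchyProfile.mono' (by fun_prop) (Eventually.of_forall fun t => ?_)
  have h1 := cauchyProfile_pos t
  have h2 := cauchyProfile_pos (s - t)
  rw [Real.norm_of_nonneg (by positivity)]
  exact mul_le_of_le_one_right h1.le (cauchyProfile_le_one _)

/-- Partial fractions give an explicit antiderivative, whose factor `1/s` is the reason for
excluding `s = 0`. Only the arctangents contribute at infinity. -/
lemma integral_cauchyProfile_mul_sub {s : ℝ} (hs : s ≠ 0) :
    ∫ t, cauchyProfile t * cauchyProfile (s - t) = 2 * Real.pi / (4 + s ^ 2) := by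
  have hlim : ∀ {l : Filter ℝ} {a : ℝ}, Tendsto (fun t : ℝ => t⁻¹) l (𝓝 0) →
      (∀ᶠ t in l, t ≠ 0) → Tendsto Real.arctan l (𝓝 a) →
      Tendsto (fun t => Real.arctan (t - s)) l (𝓝 a) →
      Tendsto (fun t => (s * (s ^ 2 + 4))⁻¹ * ((Real.log (1 + t ^ 2) - Real.log (1 + (s - t) ^ 2))
        + s * (Real.arctan t + Real.arctan (t - s)))) l
        (𝓝 ((s * (s ^ 2 + 4))⁻¹ * (0 + s * (a + a)))) := by
    intro l a h1 h2 h3 h4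
    exact ((tendsto_log_div_one_add_sq s h1 h2).add ((h3.add h4).const_mul s)).const_mul _
  have hbot := hlim tendsto_inv_atBot_zero (eventually_ne_atBot 0)
    (tendsto_nhds_of_tendsto_nhdsWithin Real.tendsto_arctan_atBot)
    ((tendsto_nhds_of_tendsto_nhdsWithin Real.tendsto_arctan_atBot).comp
      (tendsto_atBot_add_const_right _ (-s) tendsto_id))
  have htop := hlim tendsto_inv_atTop_zero (eventually_ne_atTop 0)
    (tendsto_nhds_of_tendsto_nhdsWithin Real.tendsto_arctan_atTop)
    ((tendsto_nhds_of_tendsto_nhdsWithin Real.tendsto_arctan_atTop).comp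
      (tendsto_atTop_add_const_right _ (-s) tendsto_id))
  rw [integral_of_hasDerivAt_of_tendsto (fun t => ?_) (integrable_cauchyProfile_mul_sub s) hbot htop]
  · have : s ^ 2 + 4 ≠ 0 := by positivity
    have : 4 + s ^ 2 ≠ 0 := by positivity
    field_simp
    ring
  · have h1 : (1 : ℝ) + t ^ 2 ≠ 0 := by positivity
    have h2 : (1 : ℝ) + (s - t) ^ 2 ≠ 0 := by positivity
    have h2' : (1 : ℝ) + (t - s) ^ 2 ≠ 0 := by positivity
    have h3 : s ^ 2 + 4 ≠ 0 := by positivity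
    have d1 : HasDerivAt (fun t : ℝ => 1 + t ^ 2) (2 * t) t := by
      simpa using (hasDerivAt_pow 2 t).const_add 1
    have d2 : HasDerivAt (fun t : ℝ => 1 + (s - t) ^ 2) (-(2 * (s - t))) t := by
      simpa using (((hasDerivAt_id t).const_sub s).pow 2).const_add 1
    have d3 : HasDerivAt (fun t : ℝ => t - s) 1 t := (hasDerivAt_id t).sub_const s
    have d := (((d1.log h1).sub (d2.log h2)).add
      (((Real.hasDerivAt_arctan t).add d3.arctan).const_mul s)).const_mul (s * (s ^ 2 + 4))⁻¹
    refine d.congr_deriv ?_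
    simp only [cauchyProfile]
    have e : (t - s) ^ 2 = (s - t) ^ 2 := by ring
    rw [e]
    field_simp
    ring

/-! ### The symmetric kernel -/

/-- The profile of the nonnegative kernel which arises by symmetrising products of regularised
Hilbert kernels over three points. -/
noncomputable def symKernel (p : ℝ × ℝ) : ℝ :=
  (p.1 ^ 2 + p.2 ^ 2 + (p.1 - p.2) ^ 2) / 2 *
    (cauchyProfile p.1 * cauchyProfile p.2 * cauchyProfile (p.1 - p.2))

lemma symKernel_nonneg (p : ℝ × ℝ) : 0 ≤ symKernel p := by
  have h1 := cauchyProfile_pos p.1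
  have h2 := cauchyProfile_pos p.2
  have h3 := cauchyProfile_pos (p.1 - p.2)
  unfold symKernel
  positivity

@[fun_prop]
lemma continuous_symKernel : Continuous symKernel := by
  unfold symKernel; fun_prop

/-- The sum of squares in the numerator is the sum of the three denominators minus 3. -/
lemma symKernel_eq (p : ℝ × ℝ) :
    symKernel p = (cauchyProfile p.1 * cauchyProfile p.2
      + cauchyProfile p.1 * cauchyProfile (p.1 - p.2)
      + cauchyProfile p.2 * cauchyProfile (p.1 - p.2)) / 2
      - 3 / 2 * (cauchyProfile p.1 * cauchyProfile p.2 * cauchyProfile (p.1 - p.2)) := by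
  simp only [symKernel, cauchyProfile]
  have h1 : (1 : ℝ) + p.1 ^ 2 ≠ 0 := by positivity
  have h2 : (1 : ℝ) + p.2 ^ 2 ≠ 0 := by positivity
  have h3 : (1 : ℝ) + (p.1 - p.2) ^ 2 ≠ 0 := by positivity
  field_simp
  ring

/-! ### Integrability and total mass of the symmetric kernel. -/

lemma integrable_cauchyProfile_fst_mul_snd :
    Integrable fun p : ℝ × ℝ => cauchyProfile p.1 * cauchyProfile p.2 :=
  integrable_cauchyProfile.mul_prod integrable_cauchyProfile

lemma integrable_cauchyProfile_fst_mul_sub :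
    Integrable fun p : ℝ × ℝ => cauchyProfile p.1 * cauchyProfile (p.1 - p.2) := by
  have h := (measurePreserving_prod_sub (volume : Measure ℝ)
    (volume : Measure ℝ)).integrable_comp_of_integrable integrable_cauchyProfile_fst_mul_snd
  refine h.congr (Eventually.of_forall fun p => ?_)
  simp only [Function.comp]
  rw [← cauchyProfile_neg (p.2 - p.1), neg_sub]

lemma integrable_cauchyProfile_snd_mul_sub :
    Integrable fun p : ℝ × ℝ => cauchyProfile p.2 * cauchyProfile (p.1 - p.2) := by
  refine integrable_cauchyProfile_fst_mul_sub.swap.congr (Eventually.of_forall fun p => ?_)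
  simp only [Function.comp, Prod.fst_swap, Prod.snd_swap]
  rw [← cauchyProfile_neg (p.2 - p.1), neg_sub]

lemma integrable_cauchyProfile_triple : Integrable fun p : ℝ × ℝ =>
    cauchyProfile p.1 * cauchyProfile p.2 * cauchyProfile (p.1 - p.2) := by
  refine integrable_cauchyProfile_fst_mul_snd.mono' (by fun_prop) (Eventually.of_forall fun p => ?_)
  have h1 := cauchyProfile_pos p.1
  have h2 := cauchyProfile_pos p.2
  have h3 := cauchyProfile_pos (p.1 - p.2)
  rw [Real.norm_of_nonneg (by positivity)]
  exact mul_le_of_le_one_right (by positivity) (cauchyProfile_le_one _)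

lemma integral_cauchyProfile_triple : ∫ p : ℝ × ℝ,
    cauchyProfile p.1 * cauchyProfile p.2 * cauchyProfile (p.1 - p.2) = Real.pi ^ 2 / 3 := by
  rw [Measure.volume_eq_prod, integral_prod _ integrable_cauchyProfile_triple]
  -- Convolve in `t`, then split `1 / ((1 + s²)(4 + s²))` into partial fractions.
  have h : ∀ᵐ s : ℝ, ∫ t, cauchyProfile s * cauchyProfile t * cauchyProfile (s - t) =
      2 * Real.pi / 3 * (cauchyProfile s - 1 / 4 * cauchyProfile (s / 2)) := by
    filter_upwards [Measure.ae_ne volume (0 : ℝ)] with s hs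
    simp_rw [mul_assoc, integral_const_mul, integral_cauchyProfile_mul_sub hs, cauchyProfile]
    have h1 : (1 : ℝ) + s ^ 2 ≠ 0 := by positivity
    have h2 : (4 : ℝ) + s ^ 2 ≠ 0 := by positivity
    have h3 : (1 : ℝ) + (s / 2) ^ 2 = (4 + s ^ 2) / 4 := by ring
    rw [h3]
    field_simp
    ring
  rw [integral_congr_ae h, integral_const_mul, integral_sub integrable_cauchyProfile
    ((integrable_cauchyProfile.comp_div two_ne_zero).const_mul _), integral_const_mul,
    Measure.integral_comp_div, integral_cauchyProfile]
  norm_num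
  ring

lemma integrable_symKernel : Integrable symKernel := by
  rw [funext symKernel_eq]
  exact (((integrable_cauchyProfile_fst_mul_snd.add integrable_cauchyProfile_fst_mul_sub).add
    integrable_cauchyProfile_snd_mul_sub).div_const 2).sub
      (integrable_cauchyProfile_triple.const_mul _)

/-- Each pairwise product has mass `π²` and the triple product `π²/3`, so the total is `3π²/2 -
π²/2`. -/
lemma integral_symKernel : ∫ p, symKernel p = Real.pi ^ 2 := by
  have e2 : ∫ p : ℝ × ℝ, cauchyProfile p.1 * cauchyProfile (p.1 - p.2) = Real.pi ^ 2 := by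
    rw [Measure.volume_eq_prod, integral_prod _ integrable_cauchyProfile_fst_mul_sub]
    simp_rw [integral_const_mul, integral_sub_left_eq_self cauchyProfile, integral_mul_const,
      integral_cauchyProfile]
    ring
  have e3 : ∫ p : ℝ × ℝ, cauchyProfile p.2 * cauchyProfile (p.1 - p.2) = Real.pi ^ 2 := by
    rw [Measure.volume_eq_prod, integral_prod_symm _ integrable_cauchyProfile_snd_mul_sub]
    simp_rw [integral_const_mul, integral_sub_right_eq_self cauchyProfile, integral_mul_const,
      integral_cauchyProfile]
    ring
  have e1 : ∫ p : ℝ × ℝ, cauchyProfile p.1 * cauchyProfile p.2 = Real.pi ^ 2 := by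
    rw [Measure.volume_eq_prod, integral_prod_mul, integral_cauchyProfile]
    ring
  have i12 : Integrable fun p : ℝ × ℝ => cauchyProfile p.1 * cauchyProfile p.2
      + cauchyProfile p.1 * cauchyProfile (p.1 - p.2) :=
    integrable_cauchyProfile_fst_mul_snd.add integrable_cauchyProfile_fst_mul_sub
  have i123 : Integrable fun p : ℝ × ℝ => cauchyProfile p.1 * cauchyProfile p.2
      + cauchyProfile p.1 * cauchyProfile (p.1 - p.2)
      + cauchyProfile p.2 * cauchyProfile (p.1 - p.2) :=
    i12.add integrable_cauchyProfile_snd_mul_sub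
  simp_rw [symKernel_eq]
  rw [integral_sub (i123.div_const 2) (integrable_cauchyProfile_triple.const_mul _),
    integral_div, integral_const_mul, integral_add i12 integrable_cauchyProfile_snd_mul_sub,
    integral_add integrable_cauchyProfile_fst_mul_snd integrable_cauchyProfile_fst_mul_sub,
    e1, e2, e3, integral_cauchyProfile_triple]
  ring

lemma lintegral_symKernel :
    ∫⁻ p, ENNReal.ofReal (symKernel p) = ENNReal.ofReal (Real.pi ^ 2) := by
  rw [← integral_symKernel, ofReal_integral_eq_lintegral_ofReal integrable_symKernel
    (Eventually.of_forall symKernel_nonneg)]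

end SecondaryMeasure

namespace SecondaryMeasure

/-! ### The regularised Hilbert transform and its symmetric trilinear form -/

/-- The regularised Hilbert kernel `u / (u² + ε²)`. -/
noncomputable def hilbertKernel (ε u : ℝ) : ℝ := u / (u ^ 2 + ε ^ 2)

/-- The regularised Hilbert transform on the line. -/
noncomputable def hilbertReg (ε : ℝ) (f : ℝ → ℝ) (x : ℝ) : ℝ :=
  ∫ t, hilbertKernel ε (x - t) * f t

@[fun_prop]
lemma measurable_hilbertKernel (ε : ℝ) : Measurable (hilbertKernel ε) := by
  unfold hilbertKernel; fun_prop

lemma abs_hilbertKernel_le {ε : ℝ} (hε : 0 < ε) (u : ℝ) : |hilbertKernel ε u| ≤ ε⁻¹ := by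
  have h : 0 < u ^ 2 + ε ^ 2 := by positivity
  rw [hilbertKernel, abs_div, abs_of_pos h, div_le_iff₀ h, inv_mul_eq_div, le_div_iff₀ hε]
  nlinarith [sq_nonneg (|u| - ε), sq_abs u, abs_nonneg u]

lemma integrable_hilbertKernel_mul {ε : ℝ} (hε : 0 < ε) {f : ℝ → ℝ} (hf : Integrable f) (x : ℝ) :
    Integrable fun t => hilbertKernel ε (x - t) * f t :=
  hf.bdd_mul (c := ε⁻¹) (Measurable.aestronglyMeasurable (by fun_prop))
    (Eventually.of_forall fun t => abs_hilbertKernel_le hε _)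

lemma measurable_hilbertReg (ε : ℝ) {f : ℝ → ℝ} (hf : Measurable f) :
    Measurable (hilbertReg ε f) := by
  have h : StronglyMeasurable (Function.uncurry fun x t : ℝ => hilbertKernel ε (x - t) * f t) := by
    apply Measurable.stronglyMeasurable
    simp only [Function.uncurry_def]
    fun_prop
  exact (h.integral_prod_right).measurable

lemma abs_hilbertReg_le {ε : ℝ} (hε : 0 < ε) {f : ℝ → ℝ} (hf : Integrable f) (x : ℝ) :
    |hilbertReg ε f x| ≤ ε⁻¹ * ∫ t, |f t| := by
  rw [hilbertReg, ← integral_const_mul]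
  refine (abs_integral_le_integral_abs).trans (integral_mono
    (integrable_hilbertKernel_mul hε hf x).abs (hf.abs.const_mul _) fun t => ?_)
  simp only [abs_mul]
  exact mul_le_mul_of_nonneg_right (abs_hilbertKernel_le hε _) (abs_nonneg _)

lemma hilbertReg_add {ε : ℝ} (hε : 0 < ε) {f g : ℝ → ℝ} (hf : Integrable f) (hg : Integrable g)
    (x : ℝ) : hilbertReg ε (fun t => f t + g t) x = hilbertReg ε f x + hilbertReg ε g x := by
  simp only [hilbertReg, mul_add]
  exact integral_add (integrable_hilbertKernel_mul hε hf x) (integrable_hilbertKernel_mul hε hg x)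

lemma hilbertReg_const_mul (ε c : ℝ) (f : ℝ → ℝ) (x : ℝ) :
    hilbertReg ε (fun t => c * f t) x = c * hilbertReg ε f x := by
  simp only [hilbertReg, mul_left_comm _ c, integral_const_mul]

lemma integrable_mul_hilbertReg_mul_hilbertReg {ε : ℝ} (hε : 0 < ε) {f g h : ℝ → ℝ}
    (hf : Integrable f) (hg : Integrable g) (hh : Integrable h)
    (hgm : Measurable g) (hhm : Measurable h) :
    Integrable fun x => f x * (hilbertReg ε g x * hilbertReg ε h x) := by
  refine hf.mul_bdd (c := (ε⁻¹ * ∫ t, |g t|) * (ε⁻¹ * ∫ t, |h t|))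
    ((measurable_hilbertReg ε hgm).mul (measurable_hilbertReg ε hhm)).aestronglyMeasurable
    (Eventually.of_forall fun x => ?_)
  rw [Real.norm_eq_abs, abs_mul]
  exact mul_le_mul (abs_hilbertReg_le hε hg x) (abs_hilbertReg_le hε hh x) (abs_nonneg _)
    ((abs_nonneg _).trans (abs_hilbertReg_le hε hg x))

/-- Symmetrising a product of regularised Hilbert kernels over three points produces a rescaling
of the nonnegative kernel `symKernel`. -/
lemma hilbertKernel_cyclic_sum {ε : ℝ} (hε : 0 < ε) (x y z : ℝ) :
    hilbertKernel ε (x - y) * hilbertKernel ε (x - z)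
      + hilbertKernel ε (y - z) * hilbertKernel ε (y - x)
      + hilbertKernel ε (z - x) * hilbertKernel ε (z - y)
      = (ε ^ 2)⁻¹ * symKernel (ε⁻¹ • (x - y, x - z)) := by
  have e1 : (y - x) = -(x - y) := by ring
  have e2 : (z - x) = -(x - z) := by ring
  have e3 : (y - z) = (x - z) - (x - y) := by ring
  have e4 : (z - y) = (x - y) - (x - z) := by ring
  rw [e1, e2, e3, e4]
  generalize x - y = s
  generalize x - z = t
  simp only [hilbertKernel, symKernel, cauchyProfile, Prod.smul_mk, smul_eq_mul]
  have f1 : 1 + (ε⁻¹ * s) ^ 2 = (s ^ 2 + ε ^ 2) / ε ^ 2 := by field_simp; ring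
  have f2 : 1 + (ε⁻¹ * t) ^ 2 = (t ^ 2 + ε ^ 2) / ε ^ 2 := by field_simp; ring
  have f3 : 1 + (ε⁻¹ * s - ε⁻¹ * t) ^ 2 = ((s - t) ^ 2 + ε ^ 2) / ε ^ 2 := by field_simp; ring
  have f4 : (t - s) ^ 2 = (s - t) ^ 2 := by ring
  have f5 : (-s) ^ 2 = s ^ 2 := by ring
  have f6 : (-t) ^ 2 = t ^ 2 := by ring
  rw [f1, f2, f3, f4, f5, f6]
  have h1 : s ^ 2 + ε ^ 2 ≠ 0 := by positivity
  have h2 : t ^ 2 + ε ^ 2 ≠ 0 := by positivity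
  have h3 : (s - t) ^ 2 + ε ^ 2 ≠ 0 := by positivity
  -- In the common numerator the terms free of `ε` cancel, leaving `ε² (s² + t² - s t)`.
  field_simp
  ring

lemma integrable_hilbertKernel_triple {ε : ℝ} (hε : 0 < ε) {f g h : ℝ → ℝ}
    (hf : Integrable f) (hg : Integrable g) (hh : Integrable h) :
    Integrable fun P : ℝ × ℝ × ℝ => hilbertKernel ε (P.1 - P.2.1) * hilbertKernel ε (P.1 - P.2.2) *
      (f P.1 * (g P.2.1 * h P.2.2)) := by
  refine (hf.mul_prod (hg.mul_prod hh)).bdd_mul (c := ε⁻¹ * ε⁻¹) ?_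
    (Eventually.of_forall fun P => ?_)
  · apply Measurable.aestronglyMeasurable
    fun_prop
  · rw [Real.norm_eq_abs, abs_mul]
    exact mul_le_mul (abs_hilbertKernel_le hε _) (abs_hilbertKernel_le hε _) (abs_nonneg _)
      (by positivity)

lemma integral_hilbertKernel_triple {ε : ℝ} (hε : 0 < ε) {f g h : ℝ → ℝ}
    (hf : Integrable f) (hg : Integrable g) (hh : Integrable h) :
    ∫ P : ℝ × ℝ × ℝ, hilbertKernel ε (P.1 - P.2.1) * hilbertKernel ε (P.1 - P.2.2) *
      (f P.1 * (g P.2.1 * h P.2.2)) = ∫ x, f x * (hilbertReg ε g x * hilbertReg ε h x) := by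
  have hI := integrable_hilbertKernel_triple hε hf hg hh
  rw [Measure.volume_eq_prod] at hI ⊢
  rw [integral_prod _ hI]
  congr 1 with x
  rw [hilbertReg, hilbertReg, ← integral_prod_mul, ← integral_const_mul]
  congr 1 with p
  ring

/-- The cyclic rotation of the coordinates of a triple. -/
def rotateTriple : ℝ × ℝ × ℝ ≃ᵐ ℝ × ℝ × ℝ :=
  MeasurableEquiv.prodAssoc.symm.trans MeasurableEquiv.prodComm

lemma measurePreserving_rotateTriple : MeasurePreserving rotateTriple :=
  (volume_preserving_prodAssoc.symm).trans
    (Measure.measurePreserving_swap : MeasurePreserving (Prod.swap : (ℝ × ℝ) × ℝ → ℝ × ℝ × ℝ)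
      ((volume : Measure (ℝ × ℝ)).prod volume) (volume.prod volume))

/-- The cyclic sum of the integrals of `f` against products of regularised Hilbert transforms. -/
noncomputable def hilbertForm (ε : ℝ) (f g h : ℝ → ℝ) : ℝ :=
  (∫ x, f x * (hilbertReg ε g x * hilbertReg ε h x)) +
    (∫ x, g x * (hilbertReg ε h x * hilbertReg ε f x)) +
    ∫ x, h x * (hilbertReg ε f x * hilbertReg ε g x)

lemma hilbertForm_eq_integral {ε : ℝ} (hε : 0 < ε) {f g h : ℝ → ℝ}
    (hf : Integrable f) (hg : Integrable g) (hh : Integrable h) :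
    (Integrable fun P : ℝ × ℝ × ℝ => (ε ^ 2)⁻¹ * symKernel (ε⁻¹ • (P.1 - P.2.1, P.1 - P.2.2)) *
      (f P.1 * (g P.2.1 * h P.2.2))) ∧
    hilbertForm ε f g h = ∫ P : ℝ × ℝ × ℝ,
      (ε ^ 2)⁻¹ * symKernel (ε⁻¹ • (P.1 - P.2.1, P.1 - P.2.2)) * (f P.1 * (g P.2.1 * h P.2.2)) := by
  -- One rotation sends `(x, y, z)` to `(z, x, y)`, two send it to `(y, z, x)`; these align the
  -- three cyclic terms on one triple.
  have hm := measurePreserving_rotateTriple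
  have i1 := integrable_hilbertKernel_triple hε hf hg hh
  have i2 := (hm.comp hm).integrable_comp_of_integrable
    (integrable_hilbertKernel_triple hε hg hh hf)
  have i3 := hm.integrable_comp_of_integrable (integrable_hilbertKernel_triple hε hh hf hg)
  have e : ∀ P : ℝ × ℝ × ℝ,
      (ε ^ 2)⁻¹ * symKernel (ε⁻¹ • (P.1 - P.2.1, P.1 - P.2.2)) * (f P.1 * (g P.2.1 * h P.2.2)) =
      hilbertKernel ε (P.1 - P.2.1) * hilbertKernel ε (P.1 - P.2.2) *
        (f P.1 * (g P.2.1 * h P.2.2)) +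
      hilbertKernel ε (P.2.1 - P.2.2) * hilbertKernel ε (P.2.1 - P.1) *
        (g P.2.1 * (h P.2.2 * f P.1)) +
      hilbertKernel ε (P.2.2 - P.1) * hilbertKernel ε (P.2.2 - P.2.1) *
        (h P.2.2 * (f P.1 * g P.2.1)) := fun P => by
    rw [← hilbertKernel_cyclic_sum hε]; ring
  simp_rw [e]
  refine ⟨(i1.add i2).add i3, ?_⟩
  set G : ℝ × ℝ × ℝ → ℝ := fun P => hilbertKernel ε (P.1 - P.2.1) *
    hilbertKernel ε (P.1 - P.2.2) * (g P.1 * (h P.2.1 * f P.2.2)) with hG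
  have j2 : ∫ P, G (rotateTriple (rotateTriple P)) = ∫ P, G P :=
    (hm.integral_comp' (g := fun P => G (rotateTriple P))).trans (hm.integral_comp' G)
  have j3 := hm.integral_comp' (fun P : ℝ × ℝ × ℝ => hilbertKernel ε (P.1 - P.2.1) *
      hilbertKernel ε (P.1 - P.2.2) * (h P.1 * (f P.2.1 * g P.2.2)))
  rw [hilbertForm, ← integral_hilbertKernel_triple hε hf hg hh,
    ← integral_hilbertKernel_triple hε hg hh hf, ← integral_hilbertKernel_triple hε hh hf hg,
    ← j2, ← j3]
  exact ((integral_add (i1.add i2) i3).trans (by rw [integral_add' i1 i2]; rfl)).symm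

/-- The form `hilbertForm`, written through the nonnegative kernel `symKernel`. -/
noncomputable def symForm (ε : ℝ) (f g h : ℝ → ℝ) : ℝ≥0∞ :=
  ∫⁻ p : ℝ × ℝ, ENNReal.ofReal (symKernel p) *
    ∫⁻ x, ENNReal.ofReal (f x * (g (x - ε * p.1) * h (x - ε * p.2)))

lemma lintegral_comp_sub_smul {ε : ℝ} (hε : 0 < ε) {F : ℝ × ℝ → ℝ≥0∞}
    (a : ℝ × ℝ) :
    ∫⁻ p, F (a - ε • p) = ENNReal.ofReal (ε ^ 2)⁻¹ * ∫⁻ p, F p := by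
  have h := Measure.map_addHaar_smul (volume : Measure (ℝ × ℝ)) hε.ne'
  rw [← lintegral_sub_left_eq_self (μ := (volume : Measure (ℝ × ℝ))) F a]
  have key := (Homeomorph.smulOfNeZero ε hε.ne').measurableEmbedding.lintegral_map
    (μ := (volume : Measure (ℝ × ℝ))) (fun q => F (a - q))
  refine key.symm.trans ?_
  change ∫⁻ q, F (a - q) ∂(Measure.map (fun p => ε • p) volume) = _
  rw [h, lintegral_smul_measure]
  simp [abs_of_pos hε]

/-- Tonelli and the substitution `(y, z) = (x - ε p.1, x - ε p.2)`, whose Jacobian `ε²` absorbs the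
prefactor of the kernel. -/
lemma ofReal_hilbertForm {ε : ℝ} (hε : 0 < ε) {f g h : ℝ → ℝ}
    (hf : Integrable f) (hg : Integrable g) (hh : Integrable h)
    (hfm : Measurable f) (hgm : Measurable g) (hhm : Measurable h)
    (hf0 : ∀ x, 0 ≤ f x) (hg0 : ∀ x, 0 ≤ g x) (hh0 : ∀ x, 0 ≤ h x) :
    0 ≤ hilbertForm ε f g h ∧ ENNReal.ofReal (hilbertForm ε f g h) = symForm ε f g h := by
  obtain ⟨hI, he⟩ := hilbertForm_eq_integral hε hf hg hh
  have h0 : ∀ P : ℝ × ℝ × ℝ, 0 ≤ (ε ^ 2)⁻¹ * symKernel (ε⁻¹ • (P.1 - P.2.1, P.1 - P.2.2)) *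
      (f P.1 * (g P.2.1 * h P.2.2)) := fun P =>
    mul_nonneg (mul_nonneg (by positivity) (symKernel_nonneg _))
      (mul_nonneg (hf0 _) (mul_nonneg (hg0 _) (hh0 _)))
  refine ⟨he ▸ integral_nonneg h0, ?_⟩
  rw [he, ofReal_integral_eq_lintegral_ofReal hI (Eventually.of_forall h0),
    Measure.volume_eq_prod ℝ (ℝ × ℝ), lintegral_prod _ (by fun_prop), symForm]
  simp_rw [← lintegral_const_mul' (ENNReal.ofReal (symKernel _)) _ ENNReal.ofReal_ne_top]
  symm
  rw [lintegral_lintegral_swap (by simp only [Function.uncurry_def]; fun_prop)]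
  congr 1 with x
  have key := lintegral_comp_sub_smul hε (F := fun q => ENNReal.ofReal
    (symKernel (ε⁻¹ • (x - q.1, x - q.2))) * ENNReal.ofReal (f x * (g q.1 * h q.2))) (x, x)
  rw [← lintegral_const_mul' _ _ ENNReal.ofReal_ne_top] at key
  simp only [Prod.fst_sub, Prod.snd_sub, Prod.smul_fst, Prod.smul_snd, smul_eq_mul, Prod.smul_mk,
    sub_sub_cancel, inv_mul_cancel_left₀ hε.ne'] at key ⊢
  rw [key]
  congr 1 with q
  rw [← ENNReal.ofReal_mul (symKernel_nonneg _), ← ENNReal.ofReal_mul (by positivity)]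
  congr 1
  ring

end SecondaryMeasure

namespace SecondaryMeasure

/-! ### Cubic integrability and the limit of the symmetric form -/

/-- The integral of the cube of a nonnegative function. -/
noncomputable def cubeIntegral (f : ℝ → ℝ) : ℝ≥0∞ := ∫⁻ x, ENNReal.ofReal (f x ^ 3)

lemma eLpNorm_three_pow {f : ℝ → ℝ} (hf0 : ∀ x, 0 ≤ f x) :
    eLpNorm f 3 volume ^ 3 = cubeIntegral f := by
  have h := eLpNorm_nnreal_pow_eq_lintegral (μ := volume) (f := f) (p := 3) (by norm_num)
  norm_num at h
  rw [h, cubeIntegral]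
  congr 1 with x
  rw [Real.enorm_of_nonneg (hf0 x), ← ENNReal.ofReal_pow (hf0 x)]

lemma memLp_three_iff {f : ℝ → ℝ} (hf : Measurable f) (hf0 : ∀ x, 0 ≤ f x) :
    MemLp f 3 volume ↔ cubeIntegral f < ∞ := by
  rw [← eLpNorm_three_pow hf0, MemLp]
  constructor
  · exact fun h => ENNReal.pow_lt_top h.2
  · exact fun h => ⟨hf.aestronglyMeasurable, by simpa using h⟩

lemma cubeIntegral_comp_sub (f : ℝ → ℝ) (a : ℝ) :
    cubeIntegral (fun x => f (x - a)) = cubeIntegral f :=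
  lintegral_sub_right_eq_self (fun x => ENNReal.ofReal (f x ^ 3)) a

/-- AM-GM with its factor `1/3` discarded. -/
lemma mul_mul_le_cubes {a b c : ℝ} (ha : 0 ≤ a) (hb : 0 ≤ b) (hc : 0 ≤ c) :
    a * (b * c) ≤ a ^ 3 + b ^ 3 + c ^ 3 := by
  have h : a ^ 3 + b ^ 3 + c ^ 3 - 3 * (a * (b * c)) =
      (a + b + c) * ((a - b) ^ 2 + (b - c) ^ 2 + (c - a) ^ 2) / 2 := by ring
  have h2 : 0 ≤ (a + b + c) * ((a - b) ^ 2 + (b - c) ^ 2 + (c - a) ^ 2) / 2 := by positivity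
  have h3 : 0 ≤ a * (b * c) := by positivity
  linarith

lemma lintegral_mul_mul_le_cubes {f g h : ℝ → ℝ} (hfm : Measurable f) (hgm : Measurable g)
    (hf0 : ∀ x, 0 ≤ f x) (hg0 : ∀ x, 0 ≤ g x) (hh0 : ∀ x, 0 ≤ h x) :
    ∫⁻ x, ENNReal.ofReal (f x * (g x * h x)) ≤
      cubeIntegral f + cubeIntegral g + cubeIntegral h := by
  simp only [cubeIntegral]
  rw [← lintegral_add_left (by fun_prop), ← lintegral_add_left (by fun_prop)]
  refine lintegral_mono fun x => ?_
  have h1 := pow_nonneg (hf0 x) 3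
  have h2 := pow_nonneg (hg0 x) 3
  have h3 := pow_nonneg (hh0 x) 3
  rw [← ENNReal.ofReal_add h1 h2, ← ENNReal.ofReal_add (by positivity) h3]
  exact ENNReal.ofReal_le_ofReal (mul_mul_le_cubes (hf0 x) (hg0 x) (hh0 x))

lemma lintegral_translates_le_cubes {f g h : ℝ → ℝ} (hfm : Measurable f) (hgm : Measurable g)
    (hf0 : ∀ x, 0 ≤ f x) (hg0 : ∀ x, 0 ≤ g x) (hh0 : ∀ x, 0 ≤ h x) (s t : ℝ) :
    ∫⁻ x, ENNReal.ofReal (f x * (g (x - s) * h (x - t))) ≤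
      cubeIntegral f + cubeIntegral g + cubeIntegral h := by
  have := lintegral_mul_mul_le_cubes hfm (g := fun x => g (x - s)) (h := fun x => h (x - t))
    (by fun_prop) hf0 (fun x => hg0 _) (fun x => hh0 _)
  rwa [cubeIntegral_comp_sub, cubeIntegral_comp_sub] at this

lemma symForm_le {f g h : ℝ → ℝ} (hfm : Measurable f) (hgm : Measurable g)
    (hf0 : ∀ x, 0 ≤ f x) (hg0 : ∀ x, 0 ≤ g x) (hh0 : ∀ x, 0 ≤ h x) (ε : ℝ) :
    symForm ε f g h ≤
      ENNReal.ofReal (Real.pi ^ 2) * (cubeIntegral f + cubeIntegral g + cubeIntegral h) := by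
  rw [← lintegral_symKernel, ← lintegral_mul_const _ (by fun_prop), symForm]
  exact lintegral_mono fun p => mul_le_mul_right
    (lintegral_translates_le_cubes hfm hgm hf0 hg0 hh0 _ _) _

/-- Positivity of the kernel makes the form monotone, although the Hilbert kernel changes sign. This
is what permits truncation. -/
lemma symForm_mono {f g h f' g' h' : ℝ → ℝ} (hg0 : ∀ x, 0 ≤ g x) (hh0 : ∀ x, 0 ≤ h x)
    (hf0' : ∀ x, 0 ≤ f' x) (hf : ∀ x, f x ≤ f' x) (hg : ∀ x, g x ≤ g' x)
    (hh : ∀ x, h x ≤ h' x) (ε : ℝ) : symForm ε f g h ≤ symForm ε f' g' h' := by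
  refine lintegral_mono fun p => mul_le_mul_right (lintegral_mono fun x => ?_) _
  refine ENNReal.ofReal_le_ofReal (mul_le_mul (hf _) (mul_le_mul (hg _) (hh _) (hh0 _) ?_)
    (mul_nonneg (hg0 _) (hh0 _)) (hf0' _))
  exact (hg0 _).trans (hg _)

/-! ### Continuity of translations and the limit of the symmetric form. -/

lemma tendsto_eLpNorm_translate_sub {p : ℝ≥0∞} [Fact (1 ≤ p)] (hp : p ≠ ∞) {g : ℝ → ℝ}
    (hg : MemLp g p volume) {ι : Type*} {l : Filter ι} {s : ι → ℝ} (hs : Tendsto s l (𝓝 0)) :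
    Tendsto (fun i => eLpNorm ((fun x => g (x - s i)) - g) p volume) l (𝓝 0) := by
  let T : C(ℝ, C(ℝ, ℝ)) := (ContinuousMap.mk (fun a : ℝ × ℝ => a.2 - a.1) (by fun_prop)).curry
  have hT : ∀ a, MeasurePreserving (T a) volume volume := fun a =>
    measurePreserving_sub_right volume a
  have hs' : Tendsto (fun i => T (s i)) l (𝓝 (T 0)) := (T.continuous.tendsto 0).comp hs
  have key := (tendsto_const_nhds (x := hg.toLp g)).compMeasurePreservingLp hs'
    (fun i => hT (s i)) (hT 0) hp
  have e0 : Lp.compMeasurePreserving (T 0) (hT 0) (hg.toLp g) = hg.toLp g := by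
    rw [Lp.toLp_compMeasurePreserving]
    congr 1
    ext x
    exact congrArg g (sub_zero x)
  rw [e0] at key
  simp_rw [Lp.toLp_compMeasurePreserving] at key
  exact (Lp.tendsto_Lp_iff_tendsto_eLpNorm'' _ (fun i => hg.comp_measurePreserving (hT (s i)))
    g hg).mp key

instance holderTriple_three_three : ENNReal.HolderTriple 3 3 (3 / 2) where
  inv_add_inv_eq_inv := by
    rw [ENNReal.inv_div (by simp) (by simp), ← two_mul, div_eq_mul_inv]

instance holderTriple_three_three_halves : ENNReal.HolderTriple 3 (3 / 2) 1 where
  inv_add_inv_eq_inv := by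
    rw [ENNReal.inv_div (by simp) (by simp), inv_one, ← one_div, ENNReal.div_add_div_same]
    norm_num
    exact ENNReal.div_self (by simp) (by simp)

lemma eLpNorm_one_mul_mul_le {a b c : ℝ → ℝ} (ha : AEStronglyMeasurable a volume)
    (hb : AEStronglyMeasurable b volume) (hc : AEStronglyMeasurable c volume) :
    eLpNorm (a * (b * c)) 1 volume ≤
      eLpNorm a 3 volume * (eLpNorm b 3 volume * eLpNorm c 3 volume) :=
  (eLpNorm_smul_le_mul_eLpNorm (q := 3 / 2) (hb.mul hc) ha).trans
    (mul_le_mul_right (eLpNorm_smul_le_mul_eLpNorm hc hb) _)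

lemma integrable_mul_mul_of_memLp_three {a b c : ℝ → ℝ} (ha : MemLp a 3 volume)
    (hb : MemLp b 3 volume) (hc : MemLp c 3 volume) : Integrable (a * (b * c)) :=
  memLp_one_iff_integrable.mp ((hc.mul hb (r := 3 / 2)).mul ha)

lemma tendsto_integral_mul_translates {f g h : ℝ → ℝ} (hf : MemLp f 3 volume)
    (hg : MemLp g 3 volume) (hh : MemLp h 3 volume) {ι : Type*} {l : Filter ι} {s t : ι → ℝ}
    (hs : Tendsto s l (𝓝 0)) (ht : Tendsto t l (𝓝 0)) :
    Tendsto (fun i => ∫ x, f x * (g (x - s i) * h (x - t i))) l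
      (𝓝 (∫ x, f x * (g x * h x))) := by
  have : Fact ((1 : ℝ≥0∞) ≤ 3) := ⟨by norm_num⟩
  have hgs : ∀ a : ℝ, MemLp (fun x => g (x - a)) 3 volume := fun a =>
    hg.comp_measurePreserving (measurePreserving_sub_right volume a)
  have hhs : ∀ a : ℝ, MemLp (fun x => h (x - a)) 3 volume := fun a =>
    hh.comp_measurePreserving (measurePreserving_sub_right volume a)
  have hhn : ∀ a : ℝ, eLpNorm (fun x => h (x - a)) 3 volume = eLpNorm h 3 volume := fun a =>
    eLpNorm_comp_measurePreserving hh.1 (measurePreserving_sub_right volume a)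
  refine tendsto_integral_of_L1' _ (integrable_mul_mul_of_memLp_three hf hg hh).1
    (Eventually.of_forall fun i =>
      integrable_mul_mul_of_memLp_three hf (hgs (s i)) (hhs (t i))) ?_
  have h3 : (3 : ℝ≥0∞) ≠ ∞ := by simp
  have b1 : Tendsto (fun i => eLpNorm f 3 volume *
      (eLpNorm ((fun x => g (x - s i)) - g) 3 volume * eLpNorm h 3 volume) +
      eLpNorm f 3 volume * (eLpNorm g 3 volume *
        eLpNorm ((fun x => h (x - t i)) - h) 3 volume)) l (𝓝 0) := by
    have q1 := ENNReal.Tendsto.const_mul (a := eLpNorm f 3 volume) (ENNReal.Tendsto.mul_const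
      (b := eLpNorm h 3 volume) (tendsto_eLpNorm_translate_sub h3 hg hs) (Or.inr hh.2.ne))
      (Or.inr hf.2.ne)
    have q2 := ENNReal.Tendsto.const_mul (a := eLpNorm f 3 volume) (ENNReal.Tendsto.const_mul
      (a := eLpNorm g 3 volume) (tendsto_eLpNorm_translate_sub h3 hh ht) (Or.inr hg.2.ne))
      (Or.inr hf.2.ne)
    simpa using q1.add q2
  refine tendsto_of_tendsto_of_tendsto_of_le_of_le tendsto_const_nhds b1 (fun i => zero_le)
    fun i => ?_
  -- Change one translate at a time, then apply Hölder with exponents `3, 3, 3`.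
  have e : ((fun x => f x * (g (x - s i) * h (x - t i))) - f * (g * h)) =
      f * (((fun x => g (x - s i)) - g) * fun x => h (x - t i)) +
      f * (g * ((fun x => h (x - t i)) - h)) := by
    ext x
    simp only [Pi.sub_apply, Pi.mul_apply, Pi.add_apply]
    ring
  have m1 := (hgs (s i)).sub hg
  have m2 := (hhs (t i)).sub hh
  rw [e]
  refine (eLpNorm_add_le (integrable_mul_mul_of_memLp_three hf m1 (hhs (t i))).1
    (integrable_mul_mul_of_memLp_three hf hg m2).1 le_rfl).trans ?_
  rw [← hhn (t i)]
  exact add_le_add (eLpNorm_one_mul_mul_le hf.1 m1.1 (hhs _).1)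
    (eLpNorm_one_mul_mul_le hf.1 hg.1 m2.1)

lemma tendsto_symForm {f g h : ℝ → ℝ} (hfm : Measurable f) (hgm : Measurable g)
    (hhm : Measurable h) (hf0 : ∀ x, 0 ≤ f x) (hg0 : ∀ x, 0 ≤ g x) (hh0 : ∀ x, 0 ≤ h x)
    (hf : MemLp f 3 volume) (hg : MemLp g 3 volume) (hh : MemLp h 3 volume)
    {e : ℕ → ℝ} (he : Tendsto e atTop (𝓝 0)) :
    Tendsto (fun n => symForm (e n) f g h) atTop
      (𝓝 (ENNReal.ofReal (Real.pi ^ 2 * ∫ x, f x * (g x * h x)))) := by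
  rw [ENNReal.ofReal_mul (by positivity), ← lintegral_symKernel,
    ← lintegral_mul_const _ (by fun_prop)]
  set C := cubeIntegral f + cubeIntegral g + cubeIntegral h with hC
  have hCtop : C ≠ ∞ := by
    simp only [hC, ne_eq, ENNReal.add_eq_top, not_or]
    exact ⟨⟨((memLp_three_iff hfm hf0).mp hf).ne, ((memLp_three_iff hgm hg0).mp hg).ne⟩,
      ((memLp_three_iff hhm hh0).mp hh).ne⟩
  -- The inner integral is bounded by `C` uniformly in the translations, so `C` times the kernel
  -- dominates.
  refine tendsto_lintegral_of_dominated_convergence (fun p => ENNReal.ofReal (symKernel p) * C)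
    (fun n => ?_) (fun n => Eventually.of_forall fun p => mul_le_mul_right
      (lintegral_translates_le_cubes hfm hgm hf0 hg0 hh0 _ _) _) ?_ (Eventually.of_forall fun p => ?_)
  · refine Measurable.mul (by fun_prop) (Measurable.lintegral_prod_right ?_)
    simp only [Function.uncurry_def]
    fun_prop
  · rw [lintegral_mul_const _ (by fun_prop), lintegral_symKernel]
    exact ENNReal.mul_ne_top ENNReal.ofReal_ne_top hCtop
  · have hs : ∀ a : ℝ, Tendsto (fun n => e n * a) atTop (𝓝 0) := fun a => by
      simpa using he.mul_const a
    refine ENNReal.Tendsto.const_mul ?_ (Or.inr ENNReal.ofReal_ne_top)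
    have hlim := (ENNReal.continuous_ofReal.tendsto _).comp
      (tendsto_integral_mul_translates hf hg hh (hs p.1) (hs p.2))
    refine hlim.congr fun n => ?_
    have hgs := hg.comp_measurePreserving (measurePreserving_sub_right volume (e n * p.1))
    have hhs := hh.comp_measurePreserving (measurePreserving_sub_right volume (e n * p.2))
    exact ofReal_integral_eq_lintegral_ofReal (integrable_mul_mul_of_memLp_three hf hgs hhs)
      (Eventually.of_forall fun x => mul_nonneg (hf0 _) (mul_nonneg (hg0 _) (hh0 _)))

end SecondaryMeasure

namespace SecondaryMeasure

/-! ### Uniform estimates for nonnegative integrable functions -/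

lemma integrable_cube {f : ℝ → ℝ} (hf3 : MemLp f 3 volume) :
    Integrable fun x => f x ^ 3 := by
  refine (integrable_mul_mul_of_memLp_three hf3 hf3 hf3).congr (Eventually.of_forall fun x => ?_)
  simp only [Pi.mul_apply]
  ring

/-- Measurable nonnegative integrable functions on the line. -/
structure NonnegIntegrable (f : ℝ → ℝ) : Prop where
  measurable : Measurable f
  nonneg : ∀ x, 0 ≤ f x
  integrable : Integrable f

namespace NonnegIntegrable

variable {f g h : ℝ → ℝ}

lemma add (hf : NonnegIntegrable f) (hg : NonnegIntegrable g) :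
    NonnegIntegrable fun x => f x + g x :=
  ⟨hf.measurable.add hg.measurable, fun x => add_nonneg (hf.nonneg x) (hg.nonneg x),
    hf.integrable.add hg.integrable⟩

lemma const_mul (hf : NonnegIntegrable f) {c : ℝ} (hc : 0 ≤ c) :
    NonnegIntegrable fun x => c * f x :=
  ⟨hf.measurable.const_mul c, fun x => mul_nonneg hc (hf.nonneg x), hf.integrable.const_mul c⟩

lemma indicator (hf : NonnegIntegrable f) {s : Set ℝ} (hs : MeasurableSet s) :
    NonnegIntegrable (s.indicator f) :=
  ⟨hf.measurable.indicator hs, fun _ => Set.indicator_nonneg (fun x _ => hf.nonneg x) _,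
    hf.integrable.indicator hs⟩

lemma min_const (hf : NonnegIntegrable f) {c : ℝ} (hc : 0 ≤ c) :
    NonnegIntegrable fun x => min (f x) c := by
  refine ⟨hf.measurable.min measurable_const, fun x => le_min (hf.nonneg x) hc,
    hf.integrable.mono' (hf.measurable.min measurable_const).aestronglyMeasurable
      (Eventually.of_forall fun x => ?_)⟩
  rw [Real.norm_of_nonneg (le_min (hf.nonneg x) hc)]
  exact min_le_left _ _

lemma memLp_three_min_const (hf : NonnegIntegrable f) {c : ℝ} (hc : 0 ≤ c) :
    MemLp (fun x => min (f x) c) 3 volume := by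
  have hm := hf.min_const hc
  rw [memLp_three_iff hm.measurable hm.nonneg]
  have hi : Integrable fun x => min (f x) c ^ 3 := by
    refine (hf.integrable.const_mul (c ^ 2)).mono' (hm.measurable.pow_const 3).aestronglyMeasurable
      (Eventually.of_forall fun x => ?_)
    have h0 := hm.nonneg x
    rw [Real.norm_of_nonneg (pow_nonneg h0 3), pow_succ]
    exact mul_le_mul (pow_le_pow_left₀ h0 (min_le_right _ _) 2) (min_le_left _ _) h0
      (by positivity)
  exact hi.lintegral_lt_top

lemma cubeIntegral_eq (hf : NonnegIntegrable f) (hf3 : MemLp f 3 volume) :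
    cubeIntegral f = ENNReal.ofReal (∫ x, f x ^ 3) :=
  (ofReal_integral_eq_lintegral_ofReal (integrable_cube hf3)
    (Eventually.of_forall fun x => pow_nonneg (hf.nonneg x) 3)).symm

lemma ofReal_hilbertForm {ε : ℝ} (hε : 0 < ε) (hf : NonnegIntegrable f) (hg : NonnegIntegrable g)
    (hh : NonnegIntegrable h) :
    0 ≤ hilbertForm ε f g h ∧ ENNReal.ofReal (hilbertForm ε f g h) = symForm ε f g h :=
  SecondaryMeasure.ofReal_hilbertForm hε hf.integrable hg.integrable hh.integrable
    hf.measurable hg.measurable hh.measurable hf.nonneg hg.nonneg hh.nonneg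

lemma integrable_mul_hilbertReg {ε : ℝ} (hε : 0 < ε) (hf : NonnegIntegrable f)
    (hg : NonnegIntegrable g) (hh : NonnegIntegrable h) :
    Integrable fun x => f x * (hilbertReg ε g x * hilbertReg ε h x) :=
  integrable_mul_hilbertReg_mul_hilbertReg hε hf.integrable hg.integrable hh.integrable
    hg.measurable hh.measurable

/-- A function which pairs boundedly with the square of its own regularised Hilbert transforms
is cube integrable. -/
lemma memLp_three_of_bound (hf : NonnegIntegrable f) {C : ℝ} {e : ℕ → ℝ}
    (he0 : ∀ n, 0 < e n) (he : Tendsto e atTop (𝓝 0))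
    (hC : ∀ᶠ n in atTop, ∫ x, f x * (hilbertReg (e n) f x * hilbertReg (e n) f x) ≤ C) :
    MemLp f 3 volume := by
  rw [memLp_three_iff hf.measurable hf.nonneg]
  -- The truncations are in `L³`, so their forms converge to `π²` times their cube integrals; by
  -- monotonicity these forms stay below that of `f`, which is at most `3 C`. Monotone convergence
  -- in `N` then finishes.
  have hN : ∀ N : ℕ, cubeIntegral (fun x => min (f x) N) ≤ ENNReal.ofReal (3 * C / Real.pi ^ 2) := by
    intro N
    have hm := hf.min_const (c := N) (Nat.cast_nonneg N)
    have hm3 := hf.memLp_three_min_const (c := N) (Nat.cast_nonneg N)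
    rw [hm.cubeIntegral_eq hm3]
    apply ENNReal.ofReal_le_ofReal
    rw [le_div_iff₀ (by positivity), mul_comm]
    have hlim := tendsto_symForm hm.measurable hm.measurable hm.measurable hm.nonneg hm.nonneg
      hm.nonneg hm3 hm3 hm3 he
    have hle := le_of_tendsto hlim (b := ENNReal.ofReal (3 * C)) (by
      filter_upwards [hC] with n hn
      have hmin : ∀ x, min (f x) (N : ℝ) ≤ f x := fun x => min_le_left _ _
      refine (symForm_mono hm.nonneg hm.nonneg hf.nonneg hmin hmin hmin _).trans ?_
      rw [← (ofReal_hilbertForm (he0 n) hf hf hf).2]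
      apply ENNReal.ofReal_le_ofReal
      rw [hilbertForm]
      linarith)
    have hC0 : 0 ≤ C := by
      obtain ⟨n, hn⟩ := hC.exists
      exact (integral_nonneg fun x => mul_nonneg (hf.nonneg x) (mul_self_nonneg _)).trans hn
    rw [ENNReal.ofReal_le_ofReal_iff (by positivity)] at hle
    have e3 : ∀ x, min (f x) (N : ℝ) ^ 3 =
        min (f x) (N : ℝ) * (min (f x) (N : ℝ) * min (f x) (N : ℝ)) := fun x => by ring
    simpa only [e3] using hle
  have hlim : Tendsto (fun N : ℕ => cubeIntegral fun x => min (f x) N) atTop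
      (𝓝 (cubeIntegral f)) := by
    refine lintegral_tendsto_of_tendsto_of_monotone (fun N => ?_)
      (Eventually.of_forall fun x N M hNM => ?_) (Eventually.of_forall fun x => ?_)
    · have := hf.measurable
      fun_prop
    · exact ENNReal.ofReal_le_ofReal (pow_le_pow_left₀ (le_min (hf.nonneg x) (Nat.cast_nonneg N))
        (min_le_min_left _ (Nat.cast_le.mpr hNM)) 3)
    · refine tendsto_const_nhds.congr' ?_
      filter_upwards [eventually_ge_atTop ⌈f x⌉₊] with N hN
      rw [min_eq_left ((Nat.le_ceil _).trans (Nat.cast_le.mpr hN))]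
  exact (le_of_tendsto' hlim hN).trans_lt ENNReal.ofReal_lt_top

lemma integral_mul_hilbertReg_self_le {ε : ℝ} (hε : 0 < ε) (hf : NonnegIntegrable f)
    (hf3 : MemLp f 3 volume) :
    ∫ x, f x * (hilbertReg ε f x * hilbertReg ε f x) ≤ Real.pi ^ 2 * ∫ x, f x ^ 3 := by
  have h := symForm_le hf.measurable hf.measurable hf.nonneg hf.nonneg hf.nonneg ε
  have h0 : 0 ≤ ∫ x, f x ^ 3 := integral_nonneg fun x => pow_nonneg (hf.nonneg x) 3
  rw [← (ofReal_hilbertForm hε hf hf hf).2, hf.cubeIntegral_eq hf3,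
    ← ENNReal.ofReal_add h0 h0, ← ENNReal.ofReal_add (by positivity) h0,
    ← ENNReal.ofReal_mul (by positivity), ENNReal.ofReal_le_ofReal_iff (by positivity),
    hilbertForm] at h
  linarith

/-- A weighted estimate for regularised Hilbert transforms, uniform in the regularisation. -/
lemma integral_mul_hilbertReg_sq_le {ε : ℝ} (hε : 0 < ε) (hf : NonnegIntegrable f)
    (hf3 : MemLp f 3 volume) (hg : NonnegIntegrable g) (hg3 : MemLp g 3 volume)
    {τ : ℝ} (hτ : 0 < τ) :
    ∫ x, g x * (hilbertReg ε f x * hilbertReg ε f x) ≤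
      Real.pi ^ 2 * (8 * (∫ x, f x ^ 3) / τ + 10 * τ ^ 2 * ∫ x, g x ^ 3) := by
  -- Polarisation: only the diagonal bound is available, so it is applied to `f + τ g` and to `g`.
  set u : ℝ → ℝ := fun x => f x + τ * g x with hu
  have hτg := hg.const_mul hτ.le
  have hNu : NonnegIntegrable u := hf.add hτg
  have hu3 : MemLp u 3 volume := hf3.add (hg3.const_mul τ)
  have hHu : ∀ x, hilbertReg ε u x = hilbertReg ε f x + τ * hilbertReg ε g x := fun x => by
    rw [hu, hilbertReg_add hε hf.integrable hτg.integrable, hilbertReg_const_mul]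
  have hcube : ∫ x, u x ^ 3 ≤ 4 * (∫ x, f x ^ 3) + 4 * τ ^ 3 * ∫ x, g x ^ 3 := by
    rw [← integral_const_mul, ← integral_const_mul, ← integral_add
      ((integrable_cube hf3).const_mul _) ((integrable_cube hg3).const_mul _)]
    refine integral_mono (integrable_cube hu3) (((integrable_cube hf3).const_mul _).add
      ((integrable_cube hg3).const_mul _)) fun x => ?_
    have h1 := hf.nonneg x
    have h2 : 0 ≤ τ * g x := hτg.nonneg x
    -- `4a³ + 4b³ - (a + b)³ = 3 (a + b)(a - b)²`.
    have h3 : 0 ≤ (f x + τ * g x) * (f x - τ * g x) ^ 2 := by positivity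
    simp only [hu]
    nlinarith
  have hpt : τ * ∫ x, g x * (hilbertReg ε f x * hilbertReg ε f x) ≤
      2 * (∫ x, u x * (hilbertReg ε u x * hilbertReg ε u x)) +
      2 * τ ^ 3 * ∫ x, g x * (hilbertReg ε g x * hilbertReg ε g x) := by
    have i1 := (integrable_mul_hilbertReg hε hNu hNu hNu).const_mul 2
    have i2 := (integrable_mul_hilbertReg hε hg hg hg).const_mul (2 * τ ^ 3)
    rw [← integral_const_mul, ← integral_const_mul, ← integral_const_mul, ← integral_add i1 i2]
    refine integral_mono ((integrable_mul_hilbertReg hε hg hf hf).const_mul τ) (i1.add i2)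
      fun x => ?_
    simp only [hHu]
    set a := hilbertReg ε f x
    set b := hilbertReg ε g x
    -- Right side minus left side is exactly `2 f (a + τ b)² + τ g (a + 2 τ b)²`.
    have h1 : 0 ≤ f x * (a + τ * b) ^ 2 := mul_nonneg (hf.nonneg x) (sq_nonneg _)
    have h2 : 0 ≤ τ * g x * (a + 2 * (τ * b)) ^ 2 := mul_nonneg (hτg.nonneg x) (sq_nonneg _)
    simp only [hu]
    nlinarith
  have hself := integral_mul_hilbertReg_self_le hε hNu hu3
  have hgself := integral_mul_hilbertReg_self_le hε hg hg3
  have hfin : τ * ∫ x, g x * (hilbertReg ε f x * hilbertReg ε f x) ≤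
      τ * (Real.pi ^ 2 * (8 * (∫ x, f x ^ 3) / τ + 10 * τ ^ 2 * ∫ x, g x ^ 3)) := by
    have e : τ * (Real.pi ^ 2 * (8 * (∫ x, f x ^ 3) / τ + 10 * τ ^ 2 * ∫ x, g x ^ 3)) =
        2 * (Real.pi ^ 2 * (4 * (∫ x, f x ^ 3) + 4 * τ ^ 3 * ∫ x, g x ^ 3)) +
        2 * τ ^ 3 * (Real.pi ^ 2 * ∫ x, g x ^ 3) := by
      field_simp
      ring
    rw [e]
    have k1 := mul_le_mul_of_nonneg_left hcube (sq_nonneg Real.pi)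
    have k2 := mul_le_mul_of_nonneg_left hgself (by positivity : 0 ≤ 2 * τ ^ 3)
    linarith
  exact le_of_mul_le_mul_left hfin hτ

lemma eLpNorm_one_mul_hilbertReg_le {ε : ℝ} (hε : 0 < ε) {f₁ f₂ : ℝ → ℝ}
    (hf₁ : NonnegIntegrable f₁) (hf₁3 : MemLp f₁ 3 volume) (hf₂ : NonnegIntegrable f₂)
    (hf₂3 : MemLp f₂ 3 volume) (hg : NonnegIntegrable g) (hg3 : MemLp g 3 volume)
    {τ : ℝ} (hτ : 0 < τ) :
    eLpNorm (fun x => g x * (hilbertReg ε f₁ x * hilbertReg ε f₂ x)) 1 volume ≤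
      ENNReal.ofReal (Real.pi ^ 2 * (4 * ((∫ x, f₁ x ^ 3) + ∫ x, f₂ x ^ 3) / τ +
        10 * τ ^ 2 * ∫ x, g x ^ 3)) := by
  rw [eLpNorm_one_eq_lintegral_enorm,
    ← ofReal_integral_norm_eq_lintegral_enorm (integrable_mul_hilbertReg hε hg hf₁ hf₂)]
  apply ENNReal.ofReal_le_ofReal
  have i1 := (integrable_mul_hilbertReg hε hg hf₁ hf₁).div_const 2
  have i2 := (integrable_mul_hilbertReg hε hg hf₂ hf₂).div_const 2
  have hle : ∫ x, ‖g x * (hilbertReg ε f₁ x * hilbertReg ε f₂ x)‖ ≤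
      (∫ x, g x * (hilbertReg ε f₁ x * hilbertReg ε f₁ x)) / 2 +
      (∫ x, g x * (hilbertReg ε f₂ x * hilbertReg ε f₂ x)) / 2 := by
    rw [← integral_div, ← integral_div, ← integral_add i1 i2]
    refine integral_mono (integrable_mul_hilbertReg hε hg hf₁ hf₂).norm (i1.add i2) fun x => ?_
    simp only [norm_mul, Real.norm_eq_abs, abs_of_nonneg (hg.nonneg x)]
    set a := hilbertReg ε f₁ x
    set b := hilbertReg ε f₂ x
    have h1 : 0 ≤ g x * (|a| - |b|) ^ 2 := mul_nonneg (hg.nonneg x) (sq_nonneg _)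
    have h2 : |a| ^ 2 = a ^ 2 := sq_abs a
    have h3 : |b| ^ 2 = b ^ 2 := sq_abs b
    have h4 : g x * (|a| - |b|) ^ 2 = g x * (a * a) + g x * (b * b) - 2 * (g x * (|a| * |b|)) := by
      rw [sub_sq, h2, h3]; ring
    linarith
  have e1 := integral_mul_hilbertReg_sq_le hε hf₁ hf₁3 hg hg3 hτ
  have e2 := integral_mul_hilbertReg_sq_le hε hf₂ hf₂3 hg hg3 hτ
  have e : Real.pi ^ 2 * (4 * ((∫ x, f₁ x ^ 3) + ∫ x, f₂ x ^ 3) / τ + 10 * τ ^ 2 * ∫ x, g x ^ 3) =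
      (Real.pi ^ 2 * (8 * (∫ x, f₁ x ^ 3) / τ + 10 * τ ^ 2 * ∫ x, g x ^ 3)) / 2 +
      (Real.pi ^ 2 * (8 * (∫ x, f₂ x ^ 3) / τ + 10 * τ ^ 2 * ∫ x, g x ^ 3)) / 2 := by ring
  rw [e]
  linarith

/-- Products of regularised Hilbert transforms are uniformly small against weights which are
small in `L³`. -/
lemma exists_eLpNorm_one_mul_hilbertReg_le {f₁ f₂ : ℝ → ℝ}
    (hf₁ : NonnegIntegrable f₁) (hf₁3 : MemLp f₁ 3 volume) (hf₂ : NonnegIntegrable f₂)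
    (hf₂3 : MemLp f₂ 3 volume) {η : ℝ} (hη : 0 < η) :
    ∃ b : ℝ, 0 < b ∧ ∀ g : ℝ → ℝ, NonnegIntegrable g → eLpNorm g 3 volume ≤ ENNReal.ofReal b →
      ∀ ε : ℝ, 0 < ε →
        eLpNorm (fun x => g x * (hilbertReg ε f₁ x * hilbertReg ε f₂ x)) 1 volume ≤
          ENNReal.ofReal η := by
  set A := (∫ x, f₁ x ^ 3) + ∫ x, f₂ x ^ 3 with hA
  have hA0 : 0 ≤ A := add_nonneg (integral_nonneg fun x => pow_nonneg (hf₁.nonneg x) 3)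
    (integral_nonneg fun x => pow_nonneg (hf₂.nonneg x) 3)
  -- `τ` makes the term in `1/τ` at most `η/2`, with `A + 1` keeping it positive; then `B` makes the
  -- other term at most `η/2`. The cap at 1 below ensures `b³ ≤ b`.
  set τ : ℝ := Real.pi ^ 2 * 4 * (A + 1) * 2 / η with hτ
  have hτ0 : 0 < τ := by positivity
  set B : ℝ := η / 2 / (Real.pi ^ 2 * 10 * τ ^ 2) with hB
  have hB0 : 0 < B := by positivity
  refine ⟨min 1 B, by positivity, fun g hg hgb ε hε => ?_⟩
  have hg3 : MemLp g 3 volume :=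
    ⟨hg.measurable.aestronglyMeasurable, hgb.trans_lt ENNReal.ofReal_lt_top⟩
  have hcube : ∫ x, g x ^ 3 ≤ B := by
    have h1 : cubeIntegral g ≤ ENNReal.ofReal B := by
      rw [← eLpNorm_three_pow hg.nonneg]
      refine (pow_le_pow_left' hgb 3).trans ?_
      rw [← ENNReal.ofReal_pow (by positivity)]
      apply ENNReal.ofReal_le_ofReal
      exact (pow_le_of_le_one (by positivity) (min_le_left _ _) three_ne_zero).trans
        (min_le_right _ _)
    rwa [hg.cubeIntegral_eq hg3, ENNReal.ofReal_le_ofReal_iff hB0.le] at h1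
  refine (eLpNorm_one_mul_hilbertReg_le hε hf₁ hf₁3 hf₂ hf₂3 hg hg3 hτ0).trans
    (ENNReal.ofReal_le_ofReal ?_)
  rw [← hA]
  have h1 : Real.pi ^ 2 * (4 * A / τ) ≤ η / 2 := by
    rw [← mul_div_assoc, div_le_iff₀ hτ0, hτ]
    have : η / 2 * (Real.pi ^ 2 * 4 * (A + 1) * 2 / η) = Real.pi ^ 2 * (4 * A) + Real.pi ^ 2 * 4 := by
      field_simp
    rw [this]
    nlinarith [sq_nonneg Real.pi]
  have h2 : Real.pi ^ 2 * (10 * τ ^ 2 * ∫ x, g x ^ 3) ≤ η / 2 := by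
    have := mul_le_mul_of_nonneg_left hcube (by positivity : 0 ≤ Real.pi ^ 2 * 10 * τ ^ 2)
    rw [hB, mul_div_cancel₀ _ (by positivity)] at this
    linarith
  linarith

/-- Passage to the limit in the integral of a weight against a product of regularised Hilbert
transforms which converge almost everywhere. -/
lemma tendsto_integral_mul_hilbertReg {f₁ f₂ ψ₁ ψ₂ : ℝ → ℝ}
    (hf₁ : NonnegIntegrable f₁) (hf₁3 : MemLp f₁ 3 volume) (hf₂ : NonnegIntegrable f₂)
    (hf₂3 : MemLp f₂ 3 volume) (hg : NonnegIntegrable g) (hg3 : MemLp g 3 volume)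
    {e : ℕ → ℝ} (he0 : ∀ n, 0 < e n)
    (h₁ : ∀ᵐ x, g x ≠ 0 → Tendsto (fun n => hilbertReg (e n) f₁ x) atTop (𝓝 (ψ₁ x)))
    (h₂ : ∀ᵐ x, g x ≠ 0 → Tendsto (fun n => hilbertReg (e n) f₂ x) atTop (𝓝 (ψ₂ x))) :
    Integrable (fun x => g x * (ψ₁ x * ψ₂ x)) ∧
    Tendsto (fun n => ∫ x, g x * (hilbertReg (e n) f₁ x * hilbertReg (e n) f₂ x)) atTop
      (𝓝 (∫ x, g x * (ψ₁ x * ψ₂ x))) := by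
  set F : ℕ → ℝ → ℝ := fun n x => g x * (hilbertReg (e n) f₁ x * hilbertReg (e n) f₂ x) with hF
  have hFi : ∀ n, Integrable (F n) := fun n => integrable_mul_hilbertReg (he0 n) hg hf₁ hf₂
  have hlim : ∀ᵐ x, Tendsto (fun n => F n x) atTop (𝓝 (g x * (ψ₁ x * ψ₂ x))) := by
    filter_upwards [h₁, h₂] with x hx1 hx2
    by_cases hx : g x = 0
    · simp [hF, hx]
    · exact ((hx1 hx).mul (hx2 hx)).const_mul _
  -- Fatou, with the uniform bound at `τ = 1`.
  have hmem : MemLp (fun x => g x * (ψ₁ x * ψ₂ x)) 1 volume := by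
    refine ⟨aestronglyMeasurable_of_tendsto_ae atTop (fun n => (hFi n).1) hlim, ?_⟩
    refine (Lp.eLpNorm_lim_le_liminf_eLpNorm (fun n => (hFi n).1) _ hlim).trans_lt ?_
    refine (liminf_le_of_frequently_le' (Frequently.of_forall fun n =>
      eLpNorm_one_mul_hilbertReg_le (he0 n) hf₁ hf₁3 hf₂ hf₂3 hg hg3 one_pos)).trans_lt
        ENNReal.ofReal_lt_top
  -- Localising the product amounts to localising the weight `g`, whose `L³` norm is small on small
  -- sets and far out.
  have hind : ∀ (s : Set ℝ) (n : ℕ), s.indicator (F n) =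
      fun x => s.indicator g x * (hilbertReg (e n) f₁ x * hilbertReg (e n) f₂ x) := fun s n => by
    ext x
    by_cases hx : x ∈ s <;> simp [hx, hF]
  have hui : UnifIntegrable F 1 volume := by
    intro η hη
    obtain ⟨b, hb, hbound⟩ := exists_eLpNorm_one_mul_hilbertReg_le hf₁ hf₁3 hf₂ hf₂3 hη
    obtain ⟨δ, hδ, hδ'⟩ := hg3.eLpNorm_indicator_le (by norm_num) (by simp) hb
    refine ⟨δ, hδ, fun n s hs hμs => ?_⟩
    rw [hind]
    exact hbound _ (hg.indicator hs) (hδ' s hs hμs) _ (he0 n)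
  have hut : UnifTight F 1 volume := by
    intro η hη
    obtain ⟨b, hb, hbound⟩ := exists_eLpNorm_one_mul_hilbertReg_le hf₁ hf₁3 hf₂ hf₂3
      (NNReal.coe_pos.mpr hη)
    obtain ⟨s, hs, hμs, hsb⟩ := hg3.exists_eLpNorm_indicator_compl_lt (by simp)
      (ENNReal.ofReal_pos.mpr hb).ne'
    refine ⟨s, hμs.ne, fun n => ?_⟩
    rw [hind, ← ENNReal.ofReal_coe_nnreal]
    exact hbound _ (hg.indicator hs.compl) hsb.le _ (he0 n)
  exact ⟨memLp_one_iff_integrable.mp hmem, tendsto_integral_of_L1' _ hmem.1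
    (Eventually.of_forall hFi) (tendsto_Lp_of_tendsto_ae le_rfl (by simp)
      (fun n => (hFi n).1) hmem hui hut hlim)⟩

/-- The trilinear identity between boundary Hilbert transforms and densities on the line. -/
lemma integral_hilbert_cyclic {ψf ψg ψh : ℝ → ℝ}
    (hf : NonnegIntegrable f) (hf3 : MemLp f 3 volume) (hg : NonnegIntegrable g)
    (hg3 : MemLp g 3 volume) (hh : NonnegIntegrable h) (hh3 : MemLp h 3 volume)
    {e : ℕ → ℝ} (he0 : ∀ n, 0 < e n) (he : Tendsto e atTop (𝓝 0)) {S : Set ℝ}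
    (hfS : ∀ x ∉ S, f x = 0) (hgS : ∀ x ∉ S, g x = 0) (hhS : ∀ x ∉ S, h x = 0)
    (hψf : ∀ᵐ x, x ∈ S → Tendsto (fun n => hilbertReg (e n) f x) atTop (𝓝 (ψf x)))
    (hψg : ∀ᵐ x, x ∈ S → Tendsto (fun n => hilbertReg (e n) g x) atTop (𝓝 (ψg x)))
    (hψh : ∀ᵐ x, x ∈ S → Tendsto (fun n => hilbertReg (e n) h x) atTop (𝓝 (ψh x))) :
    Integrable (fun x => f x * (ψg x * ψh x) + g x * (ψh x * ψf x) + h x * (ψf x * ψg x)) ∧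
    ∫ x, (f x * (ψg x * ψh x) + g x * (ψh x * ψf x) + h x * (ψf x * ψg x)) =
      Real.pi ^ 2 * ∫ x, f x * (g x * h x) := by
  have key : ∀ {w ψ u : ℝ → ℝ}, (∀ x ∉ S, w x = 0) →
      (∀ᵐ x, x ∈ S → Tendsto (fun n => hilbertReg (e n) u x) atTop (𝓝 (ψ x))) →
      ∀ᵐ x, w x ≠ 0 → Tendsto (fun n => hilbertReg (e n) u x) atTop (𝓝 (ψ x)) := by
    intro w ψ u hw hu
    filter_upwards [hu] with x hx hwx
    exact hx (by_contra fun hxS => hwx (hw x hxS))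
  obtain ⟨i1, t1⟩ := tendsto_integral_mul_hilbertReg hg hg3 hh hh3 hf hf3 he0
    (key hfS hψg) (key hfS hψh)
  obtain ⟨i2, t2⟩ := tendsto_integral_mul_hilbertReg hh hh3 hf hf3 hg hg3 he0
    (key hgS hψh) (key hgS hψf)
  obtain ⟨i3, t3⟩ := tendsto_integral_mul_hilbertReg hf hf3 hg hg3 hh hh3 he0
    (key hhS hψf) (key hhS hψg)
  refine ⟨(i1.add i2).add i3, ?_⟩
  have hL : Tendsto (fun n => hilbertForm (e n) f g h) atTop
      (𝓝 (Real.pi ^ 2 * ∫ x, f x * (g x * h x))) := by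
    have h0 : 0 ≤ Real.pi ^ 2 * ∫ x, f x * (g x * h x) := mul_nonneg (by positivity)
      (integral_nonneg fun x => mul_nonneg (hf.nonneg x) (mul_nonneg (hg.nonneg x) (hh.nonneg x)))
    have ht := (ENNReal.tendsto_toReal ENNReal.ofReal_ne_top).comp
      (tendsto_symForm hf.measurable hg.measurable hh.measurable hf.nonneg hg.nonneg hh.nonneg
        hf3 hg3 hh3 he)
    rw [ENNReal.toReal_ofReal h0] at ht
    refine ht.congr fun n => ?_
    obtain ⟨hn0, hn⟩ := ofReal_hilbertForm (he0 n) hf hg hh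
    simp only [Function.comp]
    rw [← hn, ENNReal.toReal_ofReal hn0]
  have i12 : Integrable fun x => f x * (ψg x * ψh x) + g x * (ψh x * ψf x) := i1.add i2
  rw [integral_add i12 i3, integral_add i1 i2]
  exact tendsto_nhds_unique ((t1.add t2).add t3) hL

end NonnegIntegrable

end SecondaryMeasure

namespace SecondaryMeasure

/-! ### Reducible densities -/

/-- A measurable nonnegative representative, vanishing off `I`, of an admissible density. -/
lemma IsAdmissibleDensity.exists_representative {I : Set ℝ} (hI : MeasurableSet I) {ρ : ℝ → ℝ}
    (hρ : IsAdmissibleDensity I ρ) :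
    ∃ f : ℝ → ℝ, NonnegIntegrable f ∧ (∀ x ∉ I, f x = 0) ∧ f =ᵐ[volume.restrict I] ρ := by
  have hi : Integrable ρ (volume.restrict I) := by
    simpa [IntegrableOn] using hρ.moments 0
  set g := hi.1.mk ρ with hg
  have hgm : Measurable g := hi.1.stronglyMeasurable_mk.measurable
  have hae : I.indicator (fun x => max (g x) 0) =ᵐ[volume.restrict I] ρ := by
    filter_upwards [hi.1.ae_eq_mk, ae_restrict_mem hI] with x hx hxI
    rw [Set.indicator_of_mem hxI, hg, ← hx, max_eq_left (hρ.nonneg x hxI)]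
  have hm : Measurable (I.indicator fun x => max (g x) 0) :=
    (hgm.max measurable_const).indicator hI
  refine ⟨I.indicator fun x => max (g x) 0, ⟨hm, fun x =>
    Set.indicator_nonneg (fun _ _ => le_max_right _ _) _, ?_⟩,
    fun x hx => Set.indicator_of_notMem hx _, hae⟩
  rw [← integrableOn_iff_integrable_of_support_subset (s := I) (Set.support_indicator_subset)]
  exact hi.congr hae.symm

lemma regReducer_eq {I : Set ℝ} {ρ f : ℝ → ℝ} (hfI : ∀ x ∉ I, f x = 0)
    (hf : f =ᵐ[volume.restrict I] ρ) (ε x : ℝ) :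
    regReducer I ρ ε x = 2 * hilbertReg ε f x := by
  have h : ∫ t in I, hilbertKernel ε (x - t) * f t = hilbertReg ε f x :=
    setIntegral_eq_integral_of_forall_compl_eq_zero fun t ht => by rw [hfI t ht, mul_zero]
  rw [regReducer, ← h]
  congr 1
  refine integral_congr_ae ?_
  filter_upwards [hf] with t ht
  rw [ht, hilbertKernel]
  ring

lemma densityMeasure_eq {I : Set ℝ} (hI : MeasurableSet I) {ρ f : ℝ → ℝ}
    (hfI : ∀ x ∉ I, f x = 0) (hf : f =ᵐ[volume.restrict I] ρ) :
    densityMeasure I ρ = volume.withDensity fun x => ENNReal.ofReal (f x) := by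
  have e : (fun x => ENNReal.ofReal (f x)) = I.indicator fun x => ENNReal.ofReal (f x) := by
    ext x
    by_cases hx : x ∈ I
    · rw [Set.indicator_of_mem hx]
    · rw [Set.indicator_of_notMem hx, hfI x hx, ENNReal.ofReal_zero]
  rw [e, withDensity_indicator hI, densityMeasure]
  refine withDensity_congr_ae ?_
  filter_upwards [hf] with x hx
  rw [hx]

lemma IsReducible.ae_tendsto_reducer {I : Set ℝ} {ρ : ℝ → ℝ} (hρ : IsReducible I ρ) :
    ∀ᵐ x ∂(volume.restrict I),
      Tendsto (fun ε => regReducer I ρ ε x) (𝓝[>] (0 : ℝ)) (𝓝 (reducer I ρ x)) := by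
  filter_upwards [hρ.exists_limit] with x hx
  exact tendsto_nhds_limUnder hx

lemma tendsto_one_div_add_nhdsGT :
    Tendsto (fun n : ℕ => 1 / ((n : ℝ) + 1)) atTop (𝓝[>] 0) :=
  tendsto_nhdsWithin_iff.mpr ⟨tendsto_one_div_add_atTop_nhds_zero_nat,
    Eventually.of_forall fun n => Set.mem_Ioi.mpr (by positivity)⟩

/-- Convergence in `L²(I, ρ)` bounds the norms of the regularised reducers, whose squares are `4 ∫ f
(H_ε f)²`. -/
lemma IsReducible.memLp_three {I : Set ℝ} (hI : MeasurableSet I) {ρ f : ℝ → ℝ}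
    (hρ : IsReducible I ρ) (hfN : NonnegIntegrable f) (hfI : ∀ x ∉ I, f x = 0)
    (hf : f =ᵐ[volume.restrict I] ρ) : MemLp f 3 volume := by
  set ν := densityMeasure I ρ with hν
  set e : ℕ → ℝ := fun n => 1 / ((n : ℝ) + 1) with he
  have he0 : ∀ n, 0 < e n := fun n => by positivity
  have hνeq : ν = volume.withDensity fun x => ENNReal.ofReal (f x) := densityMeasure_eq hI hfI hf
  have hfin : IsFiniteMeasure ν := by
    rw [hνeq]
    exact isFiniteMeasure_withDensity_ofReal hfN.integrable.2
  have hreg : ∀ n, MemLp (fun x => regReducer I ρ (e n) x) 2 ν := fun n => by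
    simp_rw [regReducer_eq hfI hf]
    refine MemLp.of_bound ((measurable_hilbertReg _ hfN.measurable).const_mul 2).aestronglyMeasurable
      (2 * ((e n)⁻¹ * ∫ t, |f t|)) (Eventually.of_forall fun x => ?_)
    rw [norm_mul, Real.norm_eq_abs, Real.norm_eq_abs, abs_two]
    exact mul_le_mul_of_nonneg_left (abs_hilbertReg_le (he0 n) hfN.integrable x) two_pos.le
  -- Measurability comes from the almost everywhere limit along the sequence `e`.
  have hφm : AEStronglyMeasurable (reducer I ρ) ν := by
    have hac : ν ≪ volume.restrict I := withDensity_absolutelyContinuous _ _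
    refine aestronglyMeasurable_of_tendsto_ae atTop (fun n => (hreg n).1) ?_
    filter_upwards [hac.ae_le hρ.ae_tendsto_reducer] with x hx
    exact hx.comp tendsto_one_div_add_nhdsGT
  have hnorm := hρ.tendsto_norm.comp tendsto_one_div_add_nhdsGT
  have hev : ∀ᶠ n in atTop,
      eLpNorm (fun x => regReducer I ρ (e n) x - reducer I ρ x) 2 ν < 1 :=
    hnorm.eventually_lt_const one_pos
  have hφ : MemLp (reducer I ρ) 2 ν := by
    obtain ⟨n, hn⟩ := hev.exists
    have hd : MemLp (fun x => regReducer I ρ (e n) x - reducer I ρ x) 2 ν :=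
      ⟨(hreg n).1.sub hφm, hn.trans ENNReal.one_lt_top⟩
    have := (hreg n).sub hd
    convert this using 1
    ext x
    simp
  set D := (1 + eLpNorm (reducer I ρ) 2 ν) ^ 2 with hD
  have hDtop : D ≠ ∞ := ENNReal.pow_ne_top (ENNReal.add_ne_top.mpr ⟨ENNReal.one_ne_top, hφ.2.ne⟩)
  refine hfN.memLp_three_of_bound (C := D.toReal) he0 tendsto_one_div_add_atTop_nhds_zero_nat ?_
  filter_upwards [hev] with n hn
  have hb : eLpNorm (fun x => regReducer I ρ (e n) x) 2 ν ^ 2 ≤ D := by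
    refine pow_le_pow_left' ?_ 2
    have h1 := eLpNorm_add_le ((hreg n).1.sub hφm) hφm (by norm_num : (1 : ℝ≥0∞) ≤ 2)
    rw [sub_add_cancel] at h1
    exact h1.trans (add_le_add hn.le le_rfl)
  have hsq : eLpNorm (fun x => regReducer I ρ (e n) x) 2 ν ^ 2 =
      ∫⁻ x, ENNReal.ofReal (f x * (4 * (hilbertReg (e n) f x * hilbertReg (e n) f x))) := by
    have h := eLpNorm_nnreal_pow_eq_lintegral (μ := ν)
      (f := fun x => regReducer I ρ (e n) x) (p := 2) (by norm_num)
    norm_num at h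
    have hm := measurable_hilbertReg (e n) hfN.measurable
    have hfm := hfN.measurable
    rw [h, hνeq]
    simp_rw [regReducer_eq hfI hf]
    rw [lintegral_withDensity_eq_lintegral_mul _ (by fun_prop) (by fun_prop)]
    congr 1 with x
    rw [Pi.mul_apply, ENNReal.ofReal_mul (hfN.nonneg x), ← ofReal_norm, ← ENNReal.ofReal_pow
      (norm_nonneg _), Real.norm_eq_abs, sq_abs]
    congr 2
    ring
  have hi : Integrable fun x => f x * (4 * (hilbertReg (e n) f x * hilbertReg (e n) f x)) := by
    refine ((hfN.integrable_mul_hilbertReg (he0 n) hfN hfN).const_mul 4).congr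
      (Eventually.of_forall fun x => ?_)
    ring
  have h0 : ∀ x, 0 ≤ f x * (hilbertReg (e n) f x * hilbertReg (e n) f x) := fun x =>
    mul_nonneg (hfN.nonneg x) (mul_self_nonneg _)
  have h0' : ∀ x, 0 ≤ f x * (4 * (hilbertReg (e n) f x * hilbertReg (e n) f x)) := fun x =>
    mul_nonneg (hfN.nonneg x) (mul_nonneg (by norm_num) (mul_self_nonneg _))
  rw [hsq, ← ofReal_integral_eq_lintegral_ofReal hi (Eventually.of_forall h0'),
    ENNReal.ofReal_le_iff_le_toReal hDtop] at hb
  -- The factor 4 is dropped, since any bound suffices.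
  refine (integral_mono (hfN.integrable_mul_hilbertReg (he0 n) hfN hfN) hi fun x => ?_).trans hb
  have := h0 x
  simp only
  linarith

/-- The trilinear identity between reducers and densities, for reducible densities. -/
lemma integral_reducer_cyclic {I : Set ℝ} (hI : MeasurableSet I) {ρ₁ ρ₂ ρ₃ : ℝ → ℝ}
    (h₁ : IsReducible I ρ₁) (h₂ : IsReducible I ρ₂) (h₃ : IsReducible I ρ₃) :
    IntegrableOn (fun x => reducer I ρ₁ x * reducer I ρ₂ x * ρ₃ x +
        reducer I ρ₁ x * reducer I ρ₃ x * ρ₂ x + reducer I ρ₂ x * reducer I ρ₃ x * ρ₁ x) I ∧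
      IntegrableOn (fun x => ρ₁ x * ρ₂ x * ρ₃ x) I ∧
      ∫ x in I, (reducer I ρ₁ x * reducer I ρ₂ x * ρ₃ x +
        reducer I ρ₁ x * reducer I ρ₃ x * ρ₂ x + reducer I ρ₂ x * reducer I ρ₃ x * ρ₁ x) =
        4 * Real.pi ^ 2 * ∫ x in I, ρ₁ x * ρ₂ x * ρ₃ x := by
  obtain ⟨f₁, hN₁, hI₁, hf₁⟩ := h₁.admissible.exists_representative hI
  obtain ⟨f₂, hN₂, hI₂, hf₂⟩ := h₂.admissible.exists_representative hI
  obtain ⟨f₃, hN₃, hI₃, hf₃⟩ := h₃.admissible.exists_representative hI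
  have hm₁ := h₁.memLp_three hI hN₁ hI₁ hf₁
  have hm₂ := h₂.memLp_three hI hN₂ hI₂ hf₂
  have hm₃ := h₃.memLp_three hI hN₃ hI₃ hf₃
  have hψ : ∀ {ρ f : ℝ → ℝ}, IsReducible I ρ → (∀ x ∉ I, f x = 0) →
      f =ᵐ[volume.restrict I] ρ → ∀ᵐ x, x ∈ I →
      Tendsto (fun n : ℕ => hilbertReg (1 / ((n : ℝ) + 1)) f x) atTop
        (𝓝 (reducer I ρ x / 2)) := by
    intro ρ f hρ hfI hf
    filter_upwards [(ae_restrict_iff' hI).mp hρ.ae_tendsto_reducer] with x hx hxI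
    refine (((hx hxI).comp tendsto_one_div_add_nhdsGT).div_const 2).congr fun n => ?_
    simp only [Function.comp]
    rw [regReducer_eq hfI hf, mul_div_cancel_left₀ _ two_ne_zero]
  obtain ⟨hint, heq⟩ := NonnegIntegrable.integral_hilbert_cyclic hN₁ hm₁ hN₂ hm₂ hN₃ hm₃
    (fun n : ℕ => by positivity) tendsto_one_div_add_atTop_nhds_zero_nat hI₁ hI₂ hI₃
    (hψ h₁ hI₁ hf₁) (hψ h₂ hI₂ hf₂) (hψ h₃ hI₃ hf₃)
  have eL : (fun x => 4 * (f₁ x * (reducer I ρ₂ x / 2 * (reducer I ρ₃ x / 2)) +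
      f₂ x * (reducer I ρ₃ x / 2 * (reducer I ρ₁ x / 2)) +
      f₃ x * (reducer I ρ₁ x / 2 * (reducer I ρ₂ x / 2)))) =ᵐ[volume.restrict I]
      fun x => reducer I ρ₁ x * reducer I ρ₂ x * ρ₃ x +
        reducer I ρ₁ x * reducer I ρ₃ x * ρ₂ x + reducer I ρ₂ x * reducer I ρ₃ x * ρ₁ x := by
    filter_upwards [hf₁, hf₂, hf₃] with x hx₁ hx₂ hx₃
    rw [hx₁, hx₂, hx₃]
    ring
  have eR : (fun x => f₁ x * (f₂ x * f₃ x)) =ᵐ[volume.restrict I]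
      fun x => ρ₁ x * ρ₂ x * ρ₃ x := by
    filter_upwards [hf₁, hf₂, hf₃] with x hx₁ hx₂ hx₃
    rw [hx₁, hx₂, hx₃]
    ring
  refine ⟨(hint.const_mul 4).integrableOn.congr eL,
    (integrable_mul_mul_of_memLp_three hm₁ hm₂ hm₃).integrableOn.congr eR, ?_⟩
  rw [← integral_congr_ae eL, ← integral_congr_ae eR,
    setIntegral_eq_integral_of_forall_compl_eq_zero fun x hx => by
      rw [hI₁ x hx, hI₂ x hx, hI₃ x hx]; ring,
    setIntegral_eq_integral_of_forall_compl_eq_zero fun x hx => by rw [hI₁ x hx]; ring,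
    integral_const_mul, heq]
  ring

end SecondaryMeasure

theorem mainTheorem2 (I : Set ℝ) (hI : I.OrdConnected) :
    (∀ ρ : ℝ → ℝ, SecondaryMeasure.IsReducible I ρ →
      IntegrableOn (fun x => (SecondaryMeasure.reducer I ρ x) ^ 2 * ρ x) I ∧
      IntegrableOn (fun x => (ρ x) ^ 3) I ∧
      ∫ x in I, (SecondaryMeasure.reducer I ρ x) ^ 2 * ρ x =
        4 * Real.pi ^ 2 / 3 * ∫ x in I, (ρ x) ^ 3) ∧
    (∀ ρ₁ ρ₂ ρ₃ : ℝ → ℝ, SecondaryMeasure.IsReducible I ρ₁ →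
      SecondaryMeasure.IsReducible I ρ₂ → SecondaryMeasure.IsReducible I ρ₃ →
      IntegrableOn (fun x => SecondaryMeasure.reducer I ρ₁ x * SecondaryMeasure.reducer I ρ₂ x *
          ρ₃ x + SecondaryMeasure.reducer I ρ₁ x * SecondaryMeasure.reducer I ρ₃ x * ρ₂ x +
          SecondaryMeasure.reducer I ρ₂ x * SecondaryMeasure.reducer I ρ₃ x * ρ₁ x) I ∧
      IntegrableOn (fun x => ρ₁ x * ρ₂ x * ρ₃ x) I ∧
      ∫ x in I, (SecondaryMeasure.reducer I ρ₁ x * SecondaryMeasure.reducer I ρ₂ x *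
          ρ₃ x + SecondaryMeasure.reducer I ρ₁ x * SecondaryMeasure.reducer I ρ₃ x * ρ₂ x +
          SecondaryMeasure.reducer I ρ₂ x * SecondaryMeasure.reducer I ρ₃ x * ρ₁ x) =
        4 * Real.pi ^ 2 * ∫ x in I, ρ₁ x * ρ₂ x * ρ₃ x) := by
  have hI' := hI.measurableSet
  refine ⟨fun ρ hρ => ?_, fun ρ₁ ρ₂ ρ₃ h₁ h₂ h₃ =>
    SecondaryMeasure.integral_reducer_cyclic hI' h₁ h₂ h₃⟩
  -- On the diagonal the three cyclic terms coincide, whence the factor `1/3`.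
  obtain ⟨h1, h2, h3⟩ := SecondaryMeasure.integral_reducer_cyclic hI' hρ hρ hρ
  have eL : ∀ x, SecondaryMeasure.reducer I ρ x * SecondaryMeasure.reducer I ρ x * ρ x +
      SecondaryMeasure.reducer I ρ x * SecondaryMeasure.reducer I ρ x * ρ x +
      SecondaryMeasure.reducer I ρ x * SecondaryMeasure.reducer I ρ x * ρ x =
      3 * (SecondaryMeasure.reducer I ρ x ^ 2 * ρ x) := fun x => by ring
  have eR : ∀ x, ρ x * ρ x * ρ x = ρ x ^ 3 := fun x => by ring
  simp only [eL, eR] at h1 h2 h3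
  refine ⟨?_, h2, ?_⟩
  · refine (h1.const_mul (1 / 3)).congr (Eventually.of_forall fun x => ?_)
    ring
  · rw [integral_const_mul] at h3
    linarith
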